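/- **Theorem (Miyachi's theorem for the two-sided quaternion Fourier transform).** Let $\mathbb{H}$ be the quaternions with the Euclidean norm $\|\cdot\|$, and let $a,b\in\mathbb{H}$ satisfy $a^2=b^2=-1$. For $f\in L^1(\mathbb{R}^2;\mathbb{H})$ put $$\mathcal{F}\{f\}(y)=\int_{\mathbb{R}^2} e^{-a x_1y_1}\,f(x)\,e^{-b x_2y_2}\,dx_1\,dx_2,\qquad y\in\mathbb{R}^2 .$$ Let $\alpha,\beta,\lambda>0$ and $1\le n,m\le\infty$. For a measurable function $f:\mathbb{R}^2\to\mathbb{H}$ consider the two conditions $$\text{(A)}\quad e^{\alpha\|x\|^2}f\in L^n(\mathbb{R}^2;\mathbb{H})+L^m(\mathbb{R}^2;\mathbb{H}),\qquad \text{(B)}\quad \int_{\mathbb{R}^2}\log^+\frac{\big\|\mathcal{F}\{f\}(y)\,e^{\beta\|y\|^2}\big\|^2}{\lambda}\,dy<\infty .$$ (Condition (A) implies $f\in L^1(\mathbb{R}^2;\mathbb{H})$, so that $\mathcal{F}\{f\}$ in (B) is defined.) 1. If $\alpha\beta>\frac14$ and $f$ satisfies (A) and (B), then $f=0$ almost everywhere.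 2. If $\alpha\beta=\frac14$ and $f$ satisfies (A) and (B), then there is $C\in\mathbb{H}$ with $\|C\|\le\frac{\alpha}{\pi}\sqrt{\lambda}$ such that $f(x)=C\,e^{-\alpha\|x\|^2}$ for almost every $x$. 3. If $\alpha\beta<\frac14$, then for every $\delta\in\,]\beta,\frac1{4\alpha}[$ and every polynomial $P:\mathbb{R}^2\to\mathbb{H}$ (that is, each of the four real components of $P$ is a real polynomial in $x_1,x_2$), the function $f(x)=\frac{1}{(2\delta)^2}P(x)\,e^{-\|x\|^2/(4\delta)}$ satisfies (A) and (B). -/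

import Mathlib

open MeasureTheory
open scoped Quaternion ENNReal

noncomputable section

namespace QFT

/-- The Euclidean plane, with its Euclidean norm and Lebesgue measure. -/
abbrev Plane : Type := EuclideanSpace ℝ (Fin 2)

/-- The two-sided quaternion Fourier transform with respect to `a` and `b`:
`∫ e^{-a x₁ y₁} f(x) e^{-b x₂ y₂} dx`, with the exponential of the Banach algebra `ℍ`. -/
def transform (a b : ℍ[ℝ]) (f : Plane → ℍ[ℝ]) (y : Plane) : ℍ[ℝ] :=
  ∫ x : Plane,
    NormedSpace.exp ((-(x 0 * y 0)) • a) * f x * NormedSpace.exp ((-(x 1 * y 1)) • b)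

/-- `e^{α‖x‖²} f` lies in `L^n(ℝ²; ℍ) + L^m(ℝ²; ℍ)`. -/
def GaussianSumMemLp (α : ℝ) (n m : ℝ≥0∞) (f : Plane → ℍ[ℝ]) : Prop :=
  ∃ u v : Plane → ℍ[ℝ], MemLp u n volume ∧ MemLp v m volume ∧
    (fun x : Plane => Real.exp (α * ‖x‖ ^ 2) • f x) =ᵐ[volume] fun x => u x + v x

/-- `∫ log⁺ (‖F{f}(y) e^{β‖y‖²}‖² / lam) dy < ∞`, an integral of a nonnegative function. -/
def LogPlusFinite (a b : ℍ[ℝ]) (β lam : ℝ) (f : Plane → ℍ[ℝ]) : Prop :=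
  ∫⁻ y : Plane,
    ENNReal.ofReal
      (Real.posLog (‖Real.exp (β * ‖y‖ ^ 2) • transform a b f y‖ ^ 2 / lam)) < ∞

/-- `P` is a polynomial function on the plane with values in `ℍ`: each of its four real
components is a real polynomial in the two coordinates. -/
def IsPolynomialFun (P : Plane → ℍ[ℝ]) : Prop :=
  ∃ p₀ p₁ p₂ p₃ : MvPolynomial (Fin 2) ℝ, ∀ x : Plane,
    P x = ⟨MvPolynomial.eval (fun i => x i) p₀, MvPolynomial.eval (fun i => x i) p₁,
      MvPolynomial.eval (fun i => x i) p₂, MvPolynomial.eval (fun i => x i) p₃⟩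

end QFT

end

/-! The quaternionic transform reduces to complex ones. For a real functional ℓ on ℍ and s = ±1,
`complexify` yields a map T_s into ℂ turning left multiplication by a into i and right
multiplication by b into s i, with ℓ = Re (T₁ + T₋₁). Hence T_s carries `transform` to a complex
Fourier transform with phase x₀y₀ + s x₁y₁.

For g = T_s ∘ f, put H(y) = e^{‖y‖²/(4α)} ĝ(y). By Hölder, (A) bounds the Laplace transform of ‖g‖
at η by a multiple of e^{‖η‖²/(4α)}. So H is entire in each variable and at most A e^{B (Re z)²},
the growth in Im z having cancelled. By (B) and Fubini, log⁺ |H| is integrable along almost every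
line parallel to an axis. The core is a Liouville theorem,
`Differentiable.apply_eq_apply_of_integrable_posLog`: such an entire function of one variable is
constant. Integrability gives no pointwise bound on ℝ, but it bounds integrals over segments of
length two. These are again subharmonic, so Phragmén–Lindelöf in sectors spreads the bound to ℂ, and
the area mean value inequality returns it to log⁺ |h|.

Thus H is constant, ĝ is a Gaussian, and g is one by uniqueness; reassembling, f = C e^{-α‖x‖²}
almost everywhere. Substituting this into (B) bounds C when αβ = 1/4 and kills it when αβ > 1/4. For
αβ < 1/4, the transform of a polynomial times a Gaussian is again of that shape, and a strict gap
between exponents absorbs the polynomial. -/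

/-! ### Continuous subharmonic functions: maximum principle and Phragmén–Lindelöf -/

/-- A continuous function on `ℂ` lying below its circle averages. -/
structure ContSubharmonic (φ : ℂ → ℝ) : Prop where
  continuous : Continuous φ
  le_circleAverage : ∀ c R, 0 < R → φ c ≤ Real.circleAverage φ c R

theorem Continuous.circleIntegrable_real {φ : ℂ → ℝ} (h : Continuous φ) (c : ℂ) (R : ℝ) :
    CircleIntegrable φ c R :=
  (h.comp (continuous_circleMap c R)).intervalIntegrable _ _

/-- Among the maximum points, take one with the largest real part. If it is interior, a small circle
about it stays in `S`, and the rightmost point of that circle cannot be a maximum point. By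
continuity the circle average is then strictly below the maximum, contradicting subharmonicity. -/
theorem ContSubharmonic.le_of_isCompact {φ : ℂ → ℝ} (hφ : ContSubharmonic φ) {S : Set ℂ}
    (hS : IsCompact S) {K : ℝ} (hK : ∀ z ∈ S, z ∉ interior S → φ z ≤ K) :
    ∀ z ∈ S, φ z ≤ K := by
  intro z₀ hz₀
  obtain ⟨m, hmS, hm⟩ := hS.exists_isMaxOn ⟨z₀, hz₀⟩ hφ.continuous.continuousOn
  by_contra! hlt
  have hmK : K < φ m := hlt.trans_le (hm hz₀)
  have hcpt : IsCompact (S ∩ {z | φ z = φ m}) :=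
    hS.inter_right (isClosed_eq hφ.continuous continuous_const)
  obtain ⟨w, ⟨hwS, hwm⟩, hw⟩ := hcpt.exists_isMaxOn ⟨m, hmS, rfl⟩ Complex.continuous_re.continuousOn
  have hwm' : φ w = φ m := hwm
  have hwi : w ∈ interior S := by
    by_contra hn
    have := hK w hwS hn
    linarith
  obtain ⟨r, hr, hrS⟩ := Metric.nhds_basis_closedBall.mem_iff.1 (mem_interior_iff_mem_nhds.1 hwi)
  have hmem : ∀ θ, circleMap w r θ ∈ S := fun θ =>
    hrS (Metric.sphere_subset_closedBall (circleMap_mem_sphere w hr.le θ))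
  have hle : ∀ θ, φ (circleMap w r θ) ≤ φ m := fun θ => hm (hmem θ)
  have h0 : φ (circleMap w r 0) < φ m := by
    refine lt_of_le_of_ne (hle 0) fun he => ?_
    have := hw (show circleMap w r 0 ∈ S ∩ {z | φ z = φ m} from ⟨hmem 0, he⟩)
    simp [circleMap] at this
    linarith
  have hint : ∫ θ in (0:ℝ)..2 * Real.pi, φ (circleMap w r θ) < ∫ θ in (0:ℝ)..2 * Real.pi, φ m :=
    intervalIntegral.integral_lt_integral_of_continuousOn_of_le_of_exists_lt Real.two_pi_pos
      (hφ.continuous.comp (continuous_circleMap w r)).continuousOn continuousOn_const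
      (fun θ _ => hle θ) ⟨0, ⟨le_rfl, Real.two_pi_pos.le⟩, h0⟩
  have h1 := hφ.le_circleAverage w r hr
  rw [Real.circleAverage_def, smul_eq_mul, hwm'] at h1
  have h2 : (2 * Real.pi)⁻¹ * ∫ θ in (0:ℝ)..2 * Real.pi, φ (circleMap w r θ) < φ m := by
    rw [inv_mul_lt_iff₀ Real.two_pi_pos]
    simpa using hint
  linarith

theorem ContSubharmonic.add_re {φ : ℂ → ℝ} (hφ : ContSubharmonic φ) {e : ℂ → ℂ}
    (he : Differentiable ℂ e) : ContSubharmonic fun z => φ z + (e z).re where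
  continuous := hφ.continuous.add (Complex.continuous_re.comp he.continuous)
  le_circleAverage c R hR := by
    have h1 : Real.circleAverage (fun z => (e z).re) c R = (e c).re := by
      have h2 := Complex.reCLM.circleAverage_comp_comm (f := e) (c := c) (R := R)
        ((he.continuous.comp (continuous_circleMap c R)).intervalIntegrable _ _)
      have h3 : Real.circleAverage e c R = e c := he.diffContOnCl.circleAverage
      rw [h3] at h2
      exact h2
    have h4 := Real.circleAverage_fun_add (f₂ := fun z => (e z).re)
      (hφ.continuous.circleIntegrable_real c R)
      ((Complex.continuous_re.comp he.continuous).circleIntegrable_real c R)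
    rw [h4, h1]
    linarith [hφ.le_circleAverage c R hR]

theorem Complex.cosh_re (w : ℂ) : (Complex.cosh w).re = Real.cosh w.re * Real.cos w.im := by
  rw [Complex.cosh, Real.cosh_eq]
  simp [Complex.exp_re]
  ring

/-- Phragmén–Lindelöf principle in a horizontal strip for continuous subharmonic functions. -/
theorem ContSubharmonic.le_of_strip {φ : ℂ → ℝ} (hφ : ContSubharmonic φ) {σ K C : ℝ}
    (hσ : 0 < σ) (hσ' : σ < Real.pi / 4) (hedge : ∀ w : ℂ, |w.im| = σ → φ w ≤ K)
    (hgrow : ∀ w : ℂ, |w.im| ≤ σ → φ w ≤ C * Real.exp (2 * |w.re|)) :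
    ∀ w : ℂ, |w.im| ≤ σ → φ w ≤ K := by
  intro w₀ hw₀
  -- γ > 2 makes cosh (γ w) outgrow e^{2|Re w|}; γσ < π/2 keeps cos (γ Im w) bounded below by c > 0
  -- on the strip.
  obtain ⟨γ, hγ2, hγσ⟩ : ∃ γ : ℝ, 2 < γ ∧ γ * σ < Real.pi / 2 := by
    have : (2 : ℝ) < Real.pi / 2 / σ := by rw [lt_div_iff₀ hσ]; linarith
    obtain ⟨γ, h1, h2⟩ := exists_between this
    exact ⟨γ, h1, by rwa [lt_div_iff₀ hσ] at h2⟩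
  have hγ0 : 0 < γ := by linarith
  set c := Real.cos (γ * σ) with hc
  have hc0 : 0 < c := Real.cos_pos_of_mem_Ioo ⟨by nlinarith [Real.pi_pos], hγσ⟩
  have hcos : ∀ w : ℂ, |w.im| ≤ σ → c ≤ Real.cos (γ * w.im) := by
    intro w hw
    rw [← Real.cos_abs (γ * w.im), abs_mul, abs_of_pos hγ0]
    exact Real.cos_le_cos_of_nonneg_of_le_pi (by positivity) (by linarith [Real.pi_pos])
      (by gcongr)
  have key : ∀ ε > 0, φ w₀ ≤ K + ε * Real.cosh (γ * w₀.re) := by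
    intro ε hε
    -- The barrier: Re e = -ε cosh (γ Re w) cos (γ Im w) is nonpositive on the strip and pushes φ
    -- below K on the vertical sides of a long rectangle. Finally ε tends to 0.
    set e : ℂ → ℂ := fun w => -(ε : ℂ) * Complex.cosh (γ * w)
    have he : Differentiable ℂ e := by
      refine (differentiable_const _).mul (Complex.differentiable_cosh.comp ?_)
      exact (differentiable_const _).mul differentiable_id
    have here : ∀ w, (e w).re = -ε * (Real.cosh (γ * w.re) * Real.cos (γ * w.im)) := by
      intro w
      have : (e w).re = -ε * (Complex.cosh (γ * w)).re := by
        simp only [e]; rw [← Complex.ofReal_neg, Complex.re_ofReal_mul]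
      rw [this, Complex.cosh_re]; simp
    have hψ := hφ.add_re he
    -- eventually the barrier dominates
    obtain ⟨T, hT0, hTw, hT⟩ : ∃ T : ℝ, 0 < T ∧ |w₀.re| ≤ T ∧
        C * Real.exp (2 * T) ≤ K + ε * c / 2 * Real.exp (γ * T) := by
      have hlim : Filter.Tendsto (fun T : ℝ => (ε * c / 2 * Real.exp ((γ - 2) * T) - C) * Real.exp (2 * T))
          Filter.atTop Filter.atTop := by
        refine Filter.Tendsto.atTop_mul_atTop₀ (Filter.tendsto_atTop_add_const_right _ _ ?_) ?_
        · refine Filter.Tendsto.const_mul_atTop (by positivity) (Real.tendsto_exp_atTop.comp ?_)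
          exact Filter.Tendsto.const_mul_atTop (by linarith) Filter.tendsto_id
        · exact Real.tendsto_exp_atTop.comp (Filter.Tendsto.const_mul_atTop two_pos Filter.tendsto_id)
      obtain ⟨T, h1, h2, h3⟩ := ((Filter.eventually_gt_atTop 0).and
        ((Filter.eventually_ge_atTop |w₀.re|).and (hlim.eventually_ge_atTop (-K)))).exists
      refine ⟨T, h1, h2, ?_⟩
      have : Real.exp (γ * T) = Real.exp ((γ - 2) * T) * Real.exp (2 * T) := by
        rw [← Real.exp_add]; ring_nf
      rw [this]; nlinarith
    have hcpt : IsCompact (Set.Icc (-T) T ×ℂ Set.Icc (-σ) σ) := isCompact_Icc.reProdIm isCompact_Icc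
    have hmax := hψ.le_of_isCompact hcpt (K := K) ?_ w₀
      ⟨abs_le.1 hTw, abs_le.1 hw₀⟩
    · rw [here] at hmax
      have : Real.cosh (γ * w₀.re) * Real.cos (γ * w₀.im) ≤ Real.cosh (γ * w₀.re) :=
        mul_le_of_le_one_right (Real.cosh_pos _).le (Real.cos_le_one _)
      nlinarith
    · rintro z ⟨hz1, hz2⟩ hzi
      rw [Complex.interior_reProdIm, interior_Icc, interior_Icc] at hzi
      have hzim : |z.im| ≤ σ := abs_le.2 hz2
      have hcz := hcos z hzim
      rw [here]
      by_cases him : |z.im| = σ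
      · have := hedge z him
        have : 0 ≤ ε * (Real.cosh (γ * z.re) * Real.cos (γ * z.im)) :=
          mul_nonneg hε.le (mul_nonneg (Real.cosh_pos _).le (hc0.le.trans hcz))
        linarith
      · have him' : |z.im| < σ := lt_of_le_of_ne hzim him
        have hre : |z.re| = T := by
          by_contra hne
          exact hzi ⟨abs_lt.1 (lt_of_le_of_ne (abs_le.2 hz1) hne), abs_lt.1 him'⟩
        have h1 := hgrow z hzim
        rw [hre] at h1
        have h2 : Real.exp (γ * T) / 2 ≤ Real.cosh (γ * z.re) := by
          rw [← Real.cosh_abs, abs_mul, abs_of_pos hγ0, hre, Real.cosh_eq]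
          linarith [Real.exp_pos (-(γ * T))]
        have h3 : Real.exp (γ * T) / 2 * c ≤ Real.cosh (γ * z.re) * Real.cos (γ * z.im) :=
          mul_le_mul h2 hcz hc0.le (Real.cosh_pos _).le
        have h4 := mul_le_mul_of_nonneg_left h3 hε.le
        nlinarith
  have hlim : Filter.Tendsto (fun ε : ℝ => K + ε * Real.cosh (γ * w₀.re)) (nhdsWithin 0 (Set.Ioi 0))
      (nhds K) := by
    have : Continuous fun ε : ℝ => K + ε * Real.cosh (γ * w₀.re) := by fun_prop
    simpa using (this.tendsto 0).mono_left nhdsWithin_le_nhds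
  exact ge_of_tendsto hlim (Filter.eventually_of_mem self_mem_nhdsWithin fun ε hε => key ε hε)

/-! ### Subharmonicity of log⁺ ‖h‖ and bounds for its segment integrals -/

/-- By Jensen's formula the circle average of log ‖h‖ exceeds log ‖h c‖ by a sum over the zeros u of
terms log (R / ‖c - u‖) ≥ 0. Passing to log⁺ only raises the average, and disposes of the case h c =
0. -/
theorem posLog_norm_le_circleAverage {h : ℂ → ℂ} (hh : Differentiable ℂ h) (c : ℂ) {R : ℝ}
    (hR : 0 < R) :
    Real.posLog ‖h c‖ ≤ Real.circleAverage (fun z => Real.posLog ‖h z‖) c R := by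
  have hcont : Continuous fun z => Real.posLog ‖h z‖ :=
    Real.continuous_posLog.comp hh.continuous.norm
  have hnn : 0 ≤ Real.circleAverage (fun z => Real.posLog ‖h z‖) c R :=
    Real.circleAverage_nonneg_of_nonneg fun z _ => Real.posLog_nonneg
  rw [Real.posLog_apply]
  refine max_le hnn ?_
  rcases eq_or_ne (h c) 0 with h0 | h0
  · simpa [h0] using hnn
  have han : AnalyticOnNhd ℂ h (Metric.closedBall c |R|) := fun z _ => hh.analyticAt z
  have hJ := han.circleAverage_log_norm hR.ne' h0
  have hsum : 0 ≤ ∑ᶠ u, MeromorphicOn.divisor h (Metric.closedBall c |R|) u * Real.log (R * ‖c - u‖⁻¹) := by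
    refine finsum_nonneg fun u => ?_
    by_cases hu : u ∈ Metric.closedBall c |R|
    · refine mul_nonneg (by exact_mod_cast MeromorphicOn.AnalyticOnNhd.divisor_nonneg han u) ?_
      -- At u = c the conventions 0⁻¹ = 0 and log 0 = 0 make the term vanish.
      rcases eq_or_ne c u with rfl | hcu
      · simp
      · refine Real.log_nonneg ?_
        have : 0 < ‖c - u‖ := norm_pos_iff.2 (sub_ne_zero.2 hcu)
        rw [← div_eq_mul_inv, le_div_iff₀ this, one_mul, ← dist_eq_norm, dist_comm]
        simpa [abs_of_pos hR] using hu
    · simp [hu]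
  calc Real.log ‖h c‖ ≤ Real.circleAverage (fun z => Real.log ‖h z‖) c R := by rw [hJ]; linarith
    _ ≤ _ := Real.circleAverage_mono (MeromorphicOn.circleIntegrable_log_norm
        fun z _ => (hh.analyticAt z).meromorphicAt) (hcont.circleIntegrable_real c R)
        fun z _ => by rw [Real.posLog_apply]; exact le_max_right _ _

/-- The integral of `log⁺ ‖h‖` over the horizontal segment of length two centred at `z`. -/
noncomputable def segmentPosLog (h : ℂ → ℂ) (z : ℂ) : ℝ :=
  ∫ t in (-1 : ℝ)..1, Real.posLog ‖h (z + t)‖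

theorem Differentiable.continuous_posLog_norm {h : ℂ → ℂ} (hh : Differentiable ℂ h) :
    Continuous fun z => Real.posLog ‖h z‖ :=
  Real.continuous_posLog.comp hh.continuous.norm

/-- Fubini exchanges the circle average with the integral over the parameter; joint continuity
supplies the integrability. -/
theorem contSubharmonic_intervalIntegral {F : ℝ → ℂ → ℝ} (hc : Continuous (Function.uncurry F))
    (hF : ∀ t, ContSubharmonic (F t)) {a b : ℝ} (hab : a ≤ b) :
    ContSubharmonic fun w => ∫ t in a..b, F t w := by
  have hc' : Continuous (Function.uncurry fun w t => F t w) := hc.comp continuous_swap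
  refine ⟨intervalIntegral.continuous_parametric_intervalIntegral_of_continuous' hc' _ _,
    fun c R hR => ?_⟩
  have hc3 : Continuous (Function.uncurry fun (t θ : ℝ) => F t (circleMap c R θ)) :=
    hc.comp (continuous_fst.prodMk ((continuous_circleMap c R).comp continuous_snd))
  have hswap : ∫ θ in (0 : ℝ)..2 * Real.pi, ∫ t in a..b, F t (circleMap c R θ) =
      ∫ t in a..b, ∫ θ in (0 : ℝ)..2 * Real.pi, F t (circleMap c R θ) := by
    refine (intervalIntegral_intervalIntegral_swap ?_).symm
    exact (hc3.continuousOn.integrableOn_compact (isCompact_uIcc.prod isCompact_uIcc)).mono_set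
      (Set.prod_mono Set.uIoc_subset_uIcc Set.uIoc_subset_uIcc)
  rw [Real.circleAverage_def, smul_eq_mul, hswap, ← intervalIntegral.integral_const_mul]
  refine intervalIntegral.integral_mono_on hab ?_ ?_ fun t _ => ?_
  · exact (hc'.comp (continuous_const.prodMk continuous_id) :
      Continuous fun t => F t c).intervalIntegrable _ _
  · exact (continuous_const.mul (intervalIntegral.continuous_parametric_intervalIntegral_of_continuous'
      hc3 _ _)).intervalIntegrable _ _
  · have := (hF t).le_circleAverage c R hR
    rwa [Real.circleAverage_def, smul_eq_mul] at this

theorem contSubharmonic_posLog_norm {h : ℂ → ℂ} (hh : Differentiable ℂ h) :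
    ContSubharmonic fun z => Real.posLog ‖h z‖ :=
  ⟨hh.continuous_posLog_norm, fun c _ hR => posLog_norm_le_circleAverage hh c hR⟩

/-- For fixed t the function h (e w + t) is entire. The inner map will be an exponential, which
unrolls a sector into a strip. -/
theorem contSubharmonic_segmentPosLog_comp {h e : ℂ → ℂ} (hh : Differentiable ℂ h)
    (he : Differentiable ℂ e) : ContSubharmonic fun w => segmentPosLog h (e w) := by
  refine contSubharmonic_intervalIntegral (F := fun t w => Real.posLog ‖h (e w + t)‖) ?_ (fun t => ?_)
    (by norm_num)
  · have hec := he.continuous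
    have h1 : Continuous fun p : ℝ × ℂ => e p.2 + (p.1 : ℂ) := by fun_prop
    exact hh.continuous_posLog_norm.comp h1
  · have hd : Differentiable ℂ fun w => h (e w + t) := hh.comp (he.add_const (t : ℂ))
    exact contSubharmonic_posLog_norm hd

theorem segmentPosLog_le_of_growth {h : ℂ → ℂ} (hh : Differentiable ℂ h) {L B : ℝ} (hB : 0 ≤ B)
    (hgrow : ∀ z, Real.posLog ‖h z‖ ≤ L + B * z.re ^ 2) (z : ℂ) :
    segmentPosLog h z ≤ 2 * L + 4 * B + 4 * B * z.re ^ 2 := by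
  have h1 : segmentPosLog h z ≤ ∫ t in (-1 : ℝ)..1, (L + 2 * B + 2 * B * z.re ^ 2) := by
    refine intervalIntegral.integral_mono_on (by norm_num) ?_ (by simp) fun t ht => ?_
    · exact (hh.continuous_posLog_norm.comp (by fun_prop)).intervalIntegrable _ _
    · refine (hgrow _).trans ?_
      have ht2 : t ^ 2 ≤ 1 := by nlinarith [ht.1, ht.2]
      have : (z.re + t) ^ 2 ≤ 2 * z.re ^ 2 + 2 := by nlinarith [sq_nonneg (z.re - t)]
      simp only [Complex.add_re, Complex.ofReal_re]
      nlinarith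
  refine h1.trans (le_of_eq ?_)
  rw [intervalIntegral.integral_const, smul_eq_mul]; ring

/-- This is the gain from integrating over segments: integrability on ℝ becomes a bound uniform in
x. -/
theorem segmentPosLog_ofReal_le {h : ℂ → ℂ} 
    (hint : Integrable fun x : ℝ => Real.posLog ‖h x‖) (x : ℝ) :
    segmentPosLog h x ≤ ∫ x : ℝ, Real.posLog ‖h x‖ := by
  have h1 : segmentPosLog h x = ∫ t in (-1 + x)..(1 + x), Real.posLog ‖h (t : ℝ)‖ := by
    rw [← intervalIntegral.integral_comp_add_right (fun t : ℝ => Real.posLog ‖h (t : ℝ)‖)]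
    simp [segmentPosLog, add_comm]
  rw [h1, intervalIntegral.integral_of_le (by linarith)]
  exact setIntegral_le_integral hint (Filter.Eventually.of_forall fun _ => Real.posLog_nonneg)

/-- The map w ↦ exp (w + iτ) sends the strip |Im w| ≤ |τ| onto the sector of arguments between 0 and
2τ. The harmonic function (B/2) cot(2τ) Im z² vanishes on the real edge and equals B (Re z)² on the
other. After subtracting it, the segment integral is at most K on both edges. Its quadratic growth
in z is e^{2|Re w|} in the strip, which Phragmén–Lindelöf tolerates because the opening 2|τ| is
below π/2. -/
theorem segmentPosLog_le_on_sector {h : ℂ → ℂ} (hh : Differentiable ℂ h) {L B K : ℝ} (hL : 0 ≤ L)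
    (hB : 0 ≤ B) (hgrow : ∀ z, segmentPosLog h z ≤ L + B * z.re ^ 2)
    (hreal : ∀ x : ℝ, segmentPosLog h x ≤ K) (hLK : L ≤ K) {τ : ℝ} (hτ0 : τ ≠ 0)
    (hτ : |τ| < Real.pi / 4) (w : ℂ) (hw : |w.im| ≤ |τ|) :
    segmentPosLog h (Complex.exp (w + τ * Complex.I)) ≤
      K + B * (Real.cos (2 * τ) / Real.sin (2 * τ)) / 2 *
        (Complex.exp (2 * (w + τ * Complex.I))).im := by
  have hs0 : Real.sin (2 * τ) ≠ 0 := by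
    rw [Ne, Real.sin_eq_zero_iff_of_lt_of_lt]
    · simpa using hτ0
    · linarith [neg_abs_le τ, Real.pi_pos]
    · linarith [le_abs_self τ, Real.pi_pos]
  set q := B * (Real.cos (2 * τ) / Real.sin (2 * τ)) with hq
  set e₁ : ℂ → ℂ := fun w => Complex.exp (w + τ * Complex.I) with he₁
  set e₂ : ℂ → ℂ := fun w => (q / 2 : ℝ) * (Complex.I * Complex.exp (2 * (w + τ * Complex.I))) with he₂
  have hd₁ : Differentiable ℂ e₁ := by fun_prop
  have hd₂ : Differentiable ℂ e₂ := by fun_prop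
  have hre : ∀ w, (e₂ w).re = -(q / 2 * (Complex.exp (2 * (w + τ * Complex.I))).im) := by
    intro w
    simp only [he₂, Complex.re_ofReal_mul, Complex.I_mul_re]; ring
  have hsub := (contSubharmonic_segmentPosLog_comp hh hd₁).add_re hd₂
  have him : ∀ w : ℂ, (Complex.exp (2 * (w + τ * Complex.I))).im =
      Real.exp (2 * w.re) * Real.sin (2 * (w.im + τ)) := by
    intro w; rw [Complex.exp_im]; simp
  have hrex : ∀ w : ℂ, (e₁ w).re = Real.exp w.re * Real.cos (w.im + τ) := by
    intro w; simp only [he₁]; rw [Complex.exp_re]; simp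
  have hexp2 : ∀ w : ℂ, Real.exp (2 * w.re) = Real.exp w.re ^ 2 := by
    intro w; rw [← Real.exp_nat_mul]; norm_num
  have hmain := hsub.le_of_strip (σ := |τ|) (K := K) (C := L + B + |q / 2|) (abs_pos.2 hτ0) hτ ?_ ?_ w hw
  · simp only [hre] at hmain
    linarith
  · intro w hw
    simp only [hre]
    rw [abs_eq_abs] at hw
    rcases hw with hw | hw
    · rw [him, hw, ← two_mul]
      have h1 := hgrow (e₁ w)
      rw [hrex, hw, ← two_mul] at h1
      have h2 : q / 2 * (Real.exp (2 * w.re) * Real.sin (2 * (2 * τ))) =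
          B * (Real.exp w.re * Real.cos (2 * τ)) ^ 2 := by
        rw [Real.sin_two_mul, hq, hexp2]; field_simp
      linarith
    · rw [him, hw]
      have h1 : e₁ w = (Real.exp w.re : ℝ) := by
        simp only [he₁]
        rw [Complex.ofReal_exp]
        congr 1
        apply Complex.ext <;> simp [hw]
      have := hreal (Real.exp w.re)
      rw [← h1] at this
      simpa using this
  · intro w hw
    simp only [hre]
    have h1 := hgrow (e₁ w)
    rw [hrex] at h1
    have hE : Real.exp (2 * w.re) ≤ Real.exp (2 * |w.re|) := by
      gcongr; exact le_abs_self _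
    have hE1 : 1 ≤ Real.exp (2 * |w.re|) := Real.one_le_exp (by positivity)
    have h2 : (Real.exp w.re * Real.cos (w.im + τ)) ^ 2 ≤ Real.exp (2 * |w.re|) := by
      rw [mul_pow, ← hexp2]
      exact (mul_le_of_le_one_right (Real.exp_pos _).le (Real.cos_sq_le_one _)).trans hE
    have h3 : -(q / 2 * (Complex.exp (2 * (w + τ * Complex.I))).im) ≤
        |q / 2| * Real.exp (2 * |w.re|) := by
      refine (neg_le_abs _).trans ?_
      rw [abs_mul, him, abs_mul, abs_of_pos (Real.exp_pos _)]
      gcongr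
      exact (mul_le_of_le_one_right (Real.exp_pos _).le (Real.abs_sin_le_one _)).trans hE
    nlinarith [mul_le_mul_of_nonneg_left hE1 hL, mul_le_mul_of_nonneg_left h2 hB]

/-- A point of the open half-plane off the real axis lies in the sector of every τ with the sign of
arg z and |arg z|/2 ≤ |τ| < π/4. As |τ| tends to π/4, cot(2τ) tends to 0 and the correction
disappears. On the imaginary axis the growth hypothesis already gives L ≤ K. -/
theorem segmentPosLog_le_of_re_nonneg {h : ℂ → ℂ} (hh : Differentiable ℂ h) {L B K : ℝ}
    (hL : 0 ≤ L) (hB : 0 ≤ B) (hgrow : ∀ z, segmentPosLog h z ≤ L + B * z.re ^ 2)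
    (hreal : ∀ x : ℝ, segmentPosLog h x ≤ K) (hLK : L ≤ K) {z : ℂ} (hz : 0 ≤ z.re) :
    segmentPosLog h z ≤ K := by
  rcases hz.eq_or_lt with h0 | hpos
  · have := hgrow z
    rw [← h0] at this
    linarith
  have hz0 : z ≠ 0 := fun h => by simp [h] at hpos
  have harg : |z.arg| < Real.pi / 2 := Complex.abs_arg_lt_pi_div_two_iff.2 (Or.inl hpos)
  rcases eq_or_ne z.arg 0 with ha | ha
  · have : z = (z.re : ℂ) := by
      have := (Complex.arg_eq_zero_iff.1 ha).2
      apply Complex.ext <;> simp [this]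
    rw [this]; exact hreal _
  have key : ∀ τ : ℝ, τ ≠ 0 → |τ| < Real.pi / 4 → |z.arg - τ| ≤ |τ| →
      segmentPosLog h z ≤ K + B * (Real.cos (2 * τ) / Real.sin (2 * τ)) / 2 * (z ^ 2).im := by
    intro τ h0 h1 h2
    have h3 := segmentPosLog_le_on_sector hh hL hB hgrow hreal hLK h0 h1
      (Complex.log z - τ * Complex.I) (by simpa [Complex.log_im] using h2)
    have h4 : Complex.exp (2 * Complex.log z) = z ^ 2 := by
      rw [two_mul, Complex.exp_add, Complex.exp_log hz0, sq]
    rwa [sub_add_cancel, Complex.exp_log hz0, h4] at h3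
  -- let `τ` tend to `± π / 4`
  have hlim : ∀ τ₀ : ℝ, Real.cos (2 * τ₀) = 0 → Real.sin (2 * τ₀) ≠ 0 →
      Filter.Tendsto (fun τ => K + B * (Real.cos (2 * τ) / Real.sin (2 * τ)) / 2 * (z ^ 2).im)
        (nhds τ₀) (nhds K) := by
    intro τ₀ hc hs
    have : ContinuousAt (fun τ => K + B * (Real.cos (2 * τ) / Real.sin (2 * τ)) / 2 * (z ^ 2).im) τ₀ := by
      fun_prop (disch := exact hs)
    simpa [ContinuousAt, hc] using this
  have hpi := Real.pi_pos
  rcases lt_or_gt_of_ne ha with hneg | hp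
  · rw [abs_of_neg hneg] at harg
    have h2 : 2 * (-(Real.pi / 4)) = -(Real.pi / 2) := by ring
    refine ge_of_tendsto ((hlim (-(Real.pi / 4)) (by rw [h2]; simp) (by rw [h2]; simp)).mono_left
      (nhdsWithin_le_nhds (s := Set.Ioi (-(Real.pi / 4))))) ?_
    filter_upwards [Ioo_mem_nhdsGT (show -(Real.pi / 4) < z.arg / 2 by linarith)] with τ hτ
    have hτ0 : τ < 0 := by linarith [hτ.2]
    refine key τ hτ0.ne (by rw [abs_of_neg hτ0]; linarith [hτ.1]) ?_
    rw [abs_of_neg hτ0, abs_le]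
    constructor <;> linarith [hτ.1, hτ.2]
  · rw [abs_of_pos hp] at harg
    have h2 : 2 * (Real.pi / 4) = Real.pi / 2 := by ring
    refine ge_of_tendsto ((hlim (Real.pi / 4) (by rw [h2]; simp) (by rw [h2]; simp)).mono_left
      (nhdsWithin_le_nhds (s := Set.Iio (Real.pi / 4)))) ?_
    filter_upwards [Ioo_mem_nhdsLT (show z.arg / 2 < Real.pi / 4 by linarith)] with τ hτ
    have hτ0 : 0 < τ := by linarith [hτ.1]
    refine key τ hτ0.ne' (by rw [abs_of_pos hτ0]; linarith [hτ.2]) ?_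
    rw [abs_of_pos hτ0, abs_le]
    constructor <;> linarith [hτ.1, hτ.2]

theorem segmentPosLog_neg (h : ℂ → ℂ) (z : ℂ) :
    segmentPosLog (fun z => h (-z)) z = segmentPosLog h (-z) := by
  unfold segmentPosLog
  have := intervalIntegral.integral_comp_neg (a := -1) (b := 1)
    (fun t : ℝ => Real.posLog ‖h (-z + t)‖)
  simp only [neg_neg] at this
  rw [← this]
  congr 1; ext t
  push_cast
  rw [neg_add]

/-- The reflection z ↦ -z preserves the hypotheses and reduces the left half-plane to the right one.
-/
theorem segmentPosLog_bounded {h : ℂ → ℂ} (hh : Differentiable ℂ h) {L B : ℝ} (hL : 0 ≤ L)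
    (hB : 0 ≤ B) (hgrow : ∀ z, Real.posLog ‖h z‖ ≤ L + B * z.re ^ 2)
    (hint : Integrable fun x : ℝ => Real.posLog ‖h x‖) :
    ∃ K, ∀ z, segmentPosLog h z ≤ K := by
  set K := max (∫ x : ℝ, Real.posLog ‖h x‖) (2 * L + 4 * B)
  have hg := segmentPosLog_le_of_growth hh hB hgrow
  have hr : ∀ x : ℝ, segmentPosLog h x ≤ K := fun x =>
    (segmentPosLog_ofReal_le hint x).trans (le_max_left _ _)
  refine ⟨K, fun z => ?_⟩
  rcases le_total 0 z.re with hz | hz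
  · exact segmentPosLog_le_of_re_nonneg hh (by positivity) (by positivity) hg hr (le_max_right _ _) hz
  · have := segmentPosLog_le_of_re_nonneg (h := fun z => h (-z)) (z := -z)
      (L := 2 * L + 4 * B) (B := 4 * B) (K := K)
      (hh.comp differentiable_neg) (by positivity) (by positivity)
      (fun z => by rw [segmentPosLog_neg]; simpa using hg (-z))
      (fun x => by rw [segmentPosLog_neg]; simpa using hr (-x)) (le_max_right _ _) (by simpa using hz)
    rwa [segmentPosLog_neg, neg_neg] at this

/-! ### From segment integrals to pointwise bounds: the Liouville theorem -/

theorem ContSubharmonic.mul_le_integral_Ioo {v : ℂ → ℝ} (hv : ContSubharmonic v) (z : ℂ) {r : ℝ}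
    (hr : 0 < r) :
    2 * Real.pi * v z ≤ ∫ θ in Set.Ioo (-Real.pi) Real.pi, v (circleMap z r θ) := by
  have h1 := hv.le_circleAverage z r hr
  rw [Real.circleAverage_eq_integral_add (-Real.pi), smul_eq_mul,
    intervalIntegral.integral_comp_add_right (fun θ => v (circleMap z r θ)),
    intervalIntegral.integral_of_le (by linarith [Real.pi_pos]), integral_Ioc_eq_integral_Ioo,
    le_inv_mul_iff₀ Real.two_pi_pos, zero_add, show 2 * Real.pi + -Real.pi = Real.pi by ring] at h1
  exact h1

/-- Integrate v over the unit disc about z in two ways. Horizontal slices lie in segments of length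
two and have heights in an interval of length two, so the integral is at most 2K. In polar
coordinates, the mean value inequality on circles bounds it below by (π/2) v z. -/
theorem ContSubharmonic.le_of_integral_segment_le {v : ℂ → ℝ} (hv : ContSubharmonic v)
    (h0 : ∀ z, 0 ≤ v z) {K : ℝ} (hK : ∀ z : ℂ, ∫ t in (-1 : ℝ)..1, v (z + t) ≤ K) (z : ℂ) :
    v z ≤ 4 * K / Real.pi := by
  have hpi := Real.pi_pos
  have hvc := hv.continuous
  have hmeas : Measurable fun w : ℂ => ENNReal.ofReal (v (z + w)) :=
    (ENNReal.continuous_ofReal.comp (hvc.comp (continuous_const.add continuous_id))).measurable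
  set f : ℂ → ℝ≥0∞ := (Metric.ball (0 : ℂ) 1).indicator fun w => ENNReal.ofReal (v (z + w)) with hf
  have hfm : Measurable f := hmeas.indicator measurableSet_ball
  have hupper : ∫⁻ w, f w ≤ ENNReal.ofReal (2 * K) := by
    rw [← (Complex.volume_preserving_equiv_real_prod.symm).lintegral_comp_emb
      Complex.measurableEquivRealProd.symm.measurableEmbedding, Measure.volume_eq_prod]
    refine (lintegral_prod_symm' (fun p : ℝ × ℝ => f (Complex.measurableEquivRealProd.symm p))
      (hfm.comp Complex.measurableEquivRealProd.symm.measurable)).trans_le ?_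
    have h1 : ∀ y : ℝ, ∫⁻ x : ℝ, f (Complex.measurableEquivRealProd.symm (x, y)) ≤
        (Set.Ioc (-1 : ℝ) 1).indicator (fun _ => ENNReal.ofReal K) y := by
      intro y
      by_cases hy : y ∈ Set.Ioc (-1 : ℝ) 1
      · rw [Set.indicator_of_mem hy]
        calc ∫⁻ x : ℝ, f (Complex.measurableEquivRealProd.symm (x, y))
            ≤ ∫⁻ x in Set.Ioc (-1 : ℝ) 1, ENNReal.ofReal (v (z + y * Complex.I + x)) := by
              rw [← lintegral_indicator measurableSet_Ioc]
              refine lintegral_mono fun x => ?_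
              by_cases hw : Complex.measurableEquivRealProd.symm (x, y) ∈ Metric.ball (0 : ℂ) 1
              · have hx : x ∈ Set.Ioc (-1 : ℝ) 1 := by
                  have h2 := (Complex.abs_re_le_norm _).trans_lt (mem_ball_zero_iff.1 hw)
                  rw [Complex.measurableEquivRealProd_symm_apply] at h2
                  exact ⟨(abs_lt.1 h2).1, (abs_lt.1 h2).2.le⟩
                rw [Set.indicator_of_mem hx, hf, Set.indicator_of_mem hw]
                refine le_of_eq ?_
                congr 2
                rw [Complex.measurableEquivRealProd_symm_apply]
                apply Complex.ext <;> simp [add_comm]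
              · rw [hf, Set.indicator_of_notMem hw]; exact zero_le
          _ = ENNReal.ofReal (∫ x in Set.Ioc (-1 : ℝ) 1, v (z + y * Complex.I + x)) := by
              rw [ofReal_integral_eq_lintegral_ofReal]
              · exact (hvc.comp (by fun_prop : Continuous fun x : ℝ =>
                  z + y * Complex.I + (x : ℂ))).integrableOn_Ioc
              · exact Filter.Eventually.of_forall fun _ => h0 _
          _ ≤ ENNReal.ofReal K := by
              refine ENNReal.ofReal_le_ofReal ?_
              rw [← intervalIntegral.integral_of_le (by norm_num)]
              exact hK _
      · have hz : ∀ x : ℝ, f (Complex.measurableEquivRealProd.symm (x, y)) = 0 := by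
          intro x
          rw [hf, Set.indicator_of_notMem]
          intro hw
          have h2 := (Complex.abs_im_le_norm _).trans_lt (mem_ball_zero_iff.1 hw)
          rw [Complex.measurableEquivRealProd_symm_apply] at h2
          exact hy ⟨(abs_lt.1 h2).1, (abs_lt.1 h2).2.le⟩
        simp only [hz, lintegral_zero]
        exact zero_le
    refine (lintegral_mono h1).trans (le_of_eq ?_)
    rw [lintegral_indicator measurableSet_Ioc, setLIntegral_const, Real.volume_Ioc,
      mul_comm, ← ENNReal.ofReal_mul (by norm_num)]
    norm_num
  have hlower : ENNReal.ofReal (Real.pi / 2 * v z) ≤ ∫⁻ w, f w := by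
    rw [← Complex.lintegral_comp_polarCoord_symm]
    -- Only the annulus 1/2 < r < 1 is kept, with the Jacobian r replaced by its lower bound 1/2:
    -- (1/2)(1/2)(2π) = π/2.
    have hsub : Set.Ioo (1 / 2 : ℝ) 1 ×ˢ Set.Ioo (-Real.pi) Real.pi ⊆ polarCoord.target :=
      Set.prod_mono (fun r hr => lt_trans (by norm_num) hr.1) le_rfl
    have hgm : Measurable fun p : ℝ × ℝ => ENNReal.ofReal (v (circleMap z p.1 p.2)) := by
      refine (ENNReal.continuous_ofReal.comp (hvc.comp ?_)).measurable
      unfold circleMap; fun_prop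
    calc ENNReal.ofReal (Real.pi / 2 * v z)
        = ∫⁻ r in Set.Ioo (1 / 2 : ℝ) 1, ENNReal.ofReal (1 / 2) * ENNReal.ofReal (2 * Real.pi * v z) := by
          rw [setLIntegral_const, Real.volume_Ioo, ← ENNReal.ofReal_mul (by norm_num),
            ← ENNReal.ofReal_mul (by have := h0 z; positivity)]
          congr 1; ring
      _ ≤ ∫⁻ r in Set.Ioo (1 / 2 : ℝ) 1, ENNReal.ofReal (1 / 2) *
            ∫⁻ θ in Set.Ioo (-Real.pi) Real.pi, ENNReal.ofReal (v (circleMap z r θ)) := by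
          refine setLIntegral_mono' measurableSet_Ioo fun r hr => ?_
          gcongr
          rw [← ofReal_integral_eq_lintegral_ofReal]
          · exact ENNReal.ofReal_le_ofReal (hv.mul_le_integral_Ioo z (lt_trans (by norm_num) hr.1))
          · exact ((hvc.comp (continuous_circleMap z r)).integrableOn_Icc).mono_set
              Set.Ioo_subset_Icc_self
          · exact Filter.Eventually.of_forall fun _ => h0 _
      _ = ∫⁻ p in Set.Ioo (1 / 2 : ℝ) 1 ×ˢ Set.Ioo (-Real.pi) Real.pi,
            ENNReal.ofReal (1 / 2) * ENNReal.ofReal (v (circleMap z p.1 p.2)) := by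
          rw [Measure.volume_eq_prod, setLIntegral_prod _ (hgm.const_mul _).aemeasurable]
          refine lintegral_congr fun r => ?_
          exact (lintegral_const_mul _ (hgm.comp (measurable_const.prodMk measurable_id))).symm
      _ ≤ ∫⁻ p in Set.Ioo (1 / 2 : ℝ) 1 ×ˢ Set.Ioo (-Real.pi) Real.pi,
            ENNReal.ofReal p.1 • f (Complex.polarCoord.symm p) := by
          refine setLIntegral_mono' (measurableSet_Ioo.prod measurableSet_Ioo) fun p hp => ?_
          have hp1 := hp.1
          rw [smul_eq_mul, hf, Set.indicator_of_mem]
          · gcongr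
            · exact hp1.1.le
            · refine le_of_eq ?_
              congr 1
              rw [Complex.polarCoord_symm_apply, circleMap, Complex.exp_mul_I]
              push_cast; rfl
          · rw [mem_ball_zero_iff, Complex.norm_polarCoord_symm, abs_of_pos (lt_trans (by norm_num) hp1.1)]
            exact hp1.2
      _ ≤ _ := lintegral_mono_set hsub
  have hfin := hlower.trans hupper
  have hK0 : 0 ≤ 2 * K := by
    have : 0 ≤ K := (intervalIntegral.integral_nonneg (by norm_num) fun _ _ => h0 _).trans (hK z)
    linarith
  rw [ENNReal.ofReal_le_ofReal_iff hK0] at hfin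
  rw [le_div_iff₀ hpi]; nlinarith

/-- An entire function with `‖h z‖ ≤ A e^{B (Re z)²}` whose `log⁺` is integrable on the real line
is constant. -/
theorem Differentiable.apply_eq_apply_of_integrable_posLog {h : ℂ → ℂ} (hh : Differentiable ℂ h)
    {A B : ℝ} (hB : 0 ≤ B) (hgrow : ∀ z, ‖h z‖ ≤ A * Real.exp (B * z.re ^ 2))
    (hint : Integrable fun x : ℝ => Real.posLog ‖h x‖) (z w : ℂ) : h z = h w := by
  have hA : 0 ≤ A := by
    have := (norm_nonneg _).trans (hgrow 0)
    simpa using this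
  have hg : ∀ z, Real.posLog ‖h z‖ ≤ Real.posLog A + B * z.re ^ 2 := by
    intro z
    refine (Real.posLog_le_posLog (norm_nonneg _) (hgrow z)).trans (Real.posLog_mul.trans ?_)
    gcongr
    rw [Real.posLog_apply, Real.log_exp]
    exact max_le (by positivity) le_rfl
  obtain ⟨K, hK⟩ := segmentPosLog_bounded hh Real.posLog_nonneg hB hg hint
  refine hh.apply_eq_apply_of_bounded (isBounded_iff_forall_norm_le.2
    ⟨Real.exp (4 * K / Real.pi), ?_⟩) z w
  rintro _ ⟨u, rfl⟩
  have h1 := (contSubharmonic_posLog_norm hh).le_of_integral_segment_le (fun _ => Real.posLog_nonneg) hK u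
  have h2 : Real.log ‖h u‖ ≤ 4 * K / Real.pi := by
    refine le_trans ?_ h1
    rw [Real.posLog_apply]; exact le_max_right _ _
  exact Real.le_exp_of_log_le h2

/-! ### Gaussian weights, Laplace transforms and the one-variable principle -/

theorem integrable_exp_neg_mul_sq_norm {V : Type*} [NormedAddCommGroup V] [InnerProductSpace ℝ V]
    [FiniteDimensional ℝ V] [MeasurableSpace V] [BorelSpace V] {κ : ℝ} (hκ : 0 < κ) :
    Integrable fun x : V => Real.exp (-κ * ‖x‖ ^ 2) := by
  have h := (GaussianFourier.integrable_cexp_neg_mul_sq_norm_add (V := V) (b := (κ : ℂ))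
    (by simpa using hκ) 0 0).norm
  refine h.congr (Filter.Eventually.of_forall fun x => ?_)
  simp only [Complex.norm_exp]
  congr 1
  simp [← Complex.ofReal_pow]

theorem memLp_exp_neg_mul_sq_norm {V : Type*} [NormedAddCommGroup V] [InnerProductSpace ℝ V]
    [FiniteDimensional ℝ V] [MeasurableSpace V] [BorelSpace V] {κ : ℝ} (hκ : 0 < κ) (p : ℝ≥0∞) :
    MemLp (fun x : V => Real.exp (-κ * ‖x‖ ^ 2)) p volume := by
  have hm : AEStronglyMeasurable (fun x : V => Real.exp (-κ * ‖x‖ ^ 2)) volume :=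
    (integrable_exp_neg_mul_sq_norm hκ).1
  rcases eq_or_ne p 0 with rfl | hp0
  · exact memLp_zero_iff_aestronglyMeasurable.2 hm
  rcases eq_or_ne p ∞ with rfl | hpt
  · refine memLp_top_of_bound hm 1 (Filter.Eventually.of_forall fun x => ?_)
    rw [Real.norm_eq_abs, Real.abs_exp, Real.exp_le_one_iff]
    nlinarith [sq_nonneg ‖x‖]
  · rw [← integrable_norm_rpow_iff hm hp0 hpt]
    have hp : 0 < p.toReal := ENNReal.toReal_pos hp0 hpt
    refine (integrable_exp_neg_mul_sq_norm (V := V) (mul_pos hκ hp)).congr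
      (Filter.Eventually.of_forall fun x => ?_)
    simp only [Real.norm_eq_abs, Real.abs_exp]
    rw [← Real.exp_mul]; congr 1; ring

/-- Hölder's inequality with the conjugate exponent; translation invariance of the norm of the
Gaussian makes the bound independent of its centre c. -/
theorem MemLp.integrable_gaussian_mul_norm {V E : Type*} [NormedAddCommGroup V]
    [InnerProductSpace ℝ V] [FiniteDimensional ℝ V] [MeasurableSpace V] [BorelSpace V]
    [NormedAddCommGroup E] {κ : ℝ} (hκ : 0 < κ) {p : ℝ≥0∞} (hp : 1 ≤ p) {u : V → E}
    (hu : MemLp u p volume) :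
    ∃ C : ℝ, ∀ c : V, Integrable (fun x => Real.exp (-κ * ‖x - c‖ ^ 2) * ‖u x‖) ∧
      ∫ x, Real.exp (-κ * ‖x - c‖ ^ 2) * ‖u x‖ ≤ C := by
  have hpq : ENNReal.HolderConjugate p (1 - p⁻¹)⁻¹ := ENNReal.HolderConjugate.inv_one_sub_inv' hp
  set q := (1 - p⁻¹)⁻¹
  have : ENNReal.HolderConjugate q p := hpq.symm
  set γ : V → ℝ := fun x => Real.exp (-κ * ‖x‖ ^ 2) with hγ
  have hγq : MemLp γ q volume := memLp_exp_neg_mul_sq_norm hκ q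
  refine ⟨(eLpNorm γ q volume * eLpNorm (fun x => ‖u x‖) p volume).toReal, fun c => ?_⟩
  have hmp := measurePreserving_sub_right (volume : Measure V) c
  have hγc : MemLp (fun x => γ (x - c)) q volume := hγq.comp_measurePreserving hmp
  have hnorm : eLpNorm (fun x => γ (x - c)) q volume = eLpNorm γ q volume :=
    eLpNorm_comp_measurePreserving hγq.1 hmp
  have hmul : MemLp ((fun x => γ (x - c)) * fun x => ‖u x‖) 1 volume := hu.norm.mul hγc
  have hint : Integrable (fun x => γ (x - c) * ‖u x‖) := memLp_one_iff_integrable.1 hmul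
  refine ⟨hint, ?_⟩
  have hnn : ∀ x, 0 ≤ γ (x - c) * ‖u x‖ := fun x => by positivity
  have h1 : ∫ x, γ (x - c) * ‖u x‖ =
      (eLpNorm ((fun x => γ (x - c)) • fun x => ‖u x‖) 1 volume).toReal := by
    rw [eLpNorm_one_eq_lintegral_enorm]
    refine Eq.trans ?_ (integral_norm_eq_lintegral_enorm hint.1)
    refine integral_congr_ae (Filter.Eventually.of_forall fun x => ?_)
    exact (Real.norm_of_nonneg (hnn x)).symm
  rw [show (∫ x, Real.exp (-κ * ‖x - c‖ ^ 2) * ‖u x‖) = ∫ x, γ (x - c) * ‖u x‖ from rfl, h1]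
  refine ENNReal.toReal_mono (ENNReal.mul_ne_top hγq.2.ne hu.norm.2.ne) ?_
  rw [← hnorm]
  exact eLpNorm_smul_le_mul_eLpNorm hu.norm.1 hγc.1

/-- If `e^{α‖x‖²} f` is in `L^n + L^m`, the Laplace transform of `‖f‖` at `η` is
`O(e^{‖η‖²/(4α)})`. -/
theorem exists_laplace_bound {V E : Type*} [NormedAddCommGroup V]
    [InnerProductSpace ℝ V] [FiniteDimensional ℝ V] [MeasurableSpace V] [BorelSpace V]
    [NormedAddCommGroup E] [NormedSpace ℝ E] {α : ℝ} (hα : 0 < α) {n m : ℝ≥0∞} (hn : 1 ≤ n)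
    (hm : 1 ≤ m) {f u v : V → E} (hf : AEStronglyMeasurable f volume) (hu : MemLp u n volume)
    (hv : MemLp v m volume)
    (huv : (fun x => Real.exp (α * ‖x‖ ^ 2) • f x) =ᵐ[volume] fun x => u x + v x) :
    ∃ C : ℝ, ∀ η : V, Integrable (fun x => Real.exp (inner ℝ η x) * ‖f x‖) ∧
      ∫ x, Real.exp (inner ℝ η x) * ‖f x‖ ≤ C * Real.exp (‖η‖ ^ 2 / (4 * α)) := by
  obtain ⟨C₁, h₁⟩ := MemLp.integrable_gaussian_mul_norm hα hn hu
  obtain ⟨C₂, h₂⟩ := MemLp.integrable_gaussian_mul_norm hα hm hv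
  refine ⟨C₁ + C₂, fun η => ?_⟩
  obtain ⟨hi₁, hb₁⟩ := h₁ ((2 * α)⁻¹ • η)
  obtain ⟨hi₂, hb₂⟩ := h₂ ((2 * α)⁻¹ • η)
  set γ : V → ℝ := fun x => Real.exp (-α * ‖x - (2 * α)⁻¹ • η‖ ^ 2) with hγ
  -- Completing the square: ⟨η, x⟩ = ‖η‖²/(4α) - α‖x - η/(2α)‖² + α‖x‖².
  have hsq : ∀ x, Real.exp (inner ℝ η x) =
      Real.exp (‖η‖ ^ 2 / (4 * α)) * (γ x * Real.exp (α * ‖x‖ ^ 2)) := by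
    intro x
    rw [hγ, ← Real.exp_add, ← Real.exp_add]
    congr 1
    rw [norm_sub_sq_real, norm_smul, inner_smul_right, real_inner_comm, Real.norm_eq_abs,
      abs_of_pos (by positivity)]
    field_simp
    ring
  have hbound : ∀ᵐ x ∂volume, Real.exp (inner ℝ η x) * ‖f x‖ ≤
      Real.exp (‖η‖ ^ 2 / (4 * α)) * (γ x * ‖u x‖ + γ x * ‖v x‖) := by
    filter_upwards [huv] with x hx
    have h3 : Real.exp (α * ‖x‖ ^ 2) * ‖f x‖ = ‖u x + v x‖ := by
      rw [← hx, norm_smul, Real.norm_eq_abs, Real.abs_exp]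
    rw [hsq, mul_assoc, mul_assoc, h3, ← mul_add]
    gcongr
    exact norm_add_le _ _
  have hint := (hi₁.add hi₂).const_mul (Real.exp (‖η‖ ^ 2 / (4 * α)))
  have hi : Integrable (fun x => Real.exp (inner ℝ η x) * ‖f x‖) := by
    refine hint.mono' ?_ ?_
    · exact (by fun_prop : Continuous fun x => Real.exp (inner ℝ η x)).aestronglyMeasurable.mul hf.norm
    · filter_upwards [hbound] with x hx
      rwa [Real.norm_of_nonneg (by positivity)]
  refine ⟨hi, (integral_mono_ae hi hint hbound).trans ?_⟩
  simp only [Pi.add_apply]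
  rw [integral_const_mul, integral_add hi₁ hi₂, mul_comm]
  gcongr

/-- Since |X| ≤ e^X + e^{-X}, a factor X costs only a shift of t by ±1. -/
theorem integrable_exp_mul_norm_mul {Ω : Type*} [MeasurableSpace Ω] {μ : Measure Ω} {X : Ω → ℝ}
    (hX : Measurable X) {g : Ω → ℂ} (hg : AEStronglyMeasurable g μ)
    (hint : ∀ t : ℝ, Integrable (fun x => Real.exp (t * X x) * ‖g x‖) μ) (t : ℝ) :
    Integrable (fun x => Real.exp (t * X x) * ‖(X x : ℂ) * g x‖) μ := by
  refine ((hint (t + 1)).add (hint (t - 1))).mono' ?_ (Filter.Eventually.of_forall fun x => ?_)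
  · exact (Real.measurable_exp.comp (hX.const_mul t)).aestronglyMeasurable.mul
      (((Complex.measurable_ofReal.comp hX).aestronglyMeasurable).mul hg).norm
  · rw [Real.norm_of_nonneg (by positivity), norm_mul, Complex.norm_real, Real.norm_eq_abs,
      Pi.add_apply, ← add_mul, ← mul_assoc]
    gcongr
    rw [show (t + 1) * X x = t * X x + X x by ring, show (t - 1) * X x = t * X x + -X x by ring,
      Real.exp_add, Real.exp_add, ← mul_add]
    gcongr
    rw [abs_le]
    have h1 := Real.add_one_le_exp (X x)
    have h2 := Real.add_one_le_exp (-X x)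
    constructor <;> linarith [Real.exp_pos (X x), Real.exp_pos (-X x)]

/-- A two-sided Laplace transform may be differentiated under the integral sign. -/
theorem hasDerivAt_integral_cexp_mul {Ω : Type*} [MeasurableSpace Ω] {μ : Measure Ω} {X : Ω → ℝ}
    (hX : Measurable X) {g : Ω → ℂ} (hg : AEStronglyMeasurable g μ)
    (hint : ∀ t : ℝ, Integrable (fun x => Real.exp (t * X x) * ‖g x‖) μ) (w : ℂ) :
    HasDerivAt (fun w : ℂ => ∫ x, Complex.exp (w * X x) * g x ∂μ)
      (∫ x, Complex.exp (w * X x) * (X x * g x) ∂μ) w := by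
  have hXc : Measurable fun x => (X x : ℂ) := Complex.measurable_ofReal.comp hX
  have hem : ∀ w : ℂ, AEStronglyMeasurable (fun x => Complex.exp (w * X x)) μ := fun w =>
    (Complex.measurable_exp.comp (hXc.const_mul w)).aestronglyMeasurable
  have hXg : AEStronglyMeasurable (fun x => (X x : ℂ) * g x) μ := hXc.aestronglyMeasurable.mul hg
  have hnorm : ∀ (w : ℂ) (k : ℂ) x, ‖Complex.exp (w * X x) * k‖ = Real.exp (w.re * X x) * ‖k‖ := by
    intro w k x
    rw [norm_mul, Complex.norm_exp]; simp
  have hint' := integrable_exp_mul_norm_mul hX hg hint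
  -- On the unit disc about w, e^{(Re w') X} is dominated by one of the exponentials with rate Re w
  -- ± 1, according to the sign of X; their sum serves for both signs.
  refine (hasDerivAt_integral_of_dominated_loc_of_deriv_le (Metric.ball_mem_nhds w one_pos)
    (F' := fun w x => Complex.exp (w * X x) * (X x * g x))
    (bound := fun x => Real.exp ((w.re + 1) * X x) * ‖(X x : ℂ) * g x‖ +
      Real.exp ((w.re - 1) * X x) * ‖(X x : ℂ) * g x‖)
    (Filter.Eventually.of_forall fun w => (hem w).mul hg) ?_ ((hem w).mul hXg) ?_
    ((hint' _).add (hint' _)) ?_).2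
  · exact (integrable_norm_iff ((hem w).mul hg)).1
      ((hint w.re).congr (Filter.Eventually.of_forall fun x => (hnorm w _ x).symm))
  · refine Filter.Eventually.of_forall fun x w' hw' => ?_
    rw [hnorm, ← add_mul]
    gcongr
    have hre : |w'.re - w.re| < 1 := by
      have := (Complex.abs_re_le_norm (w' - w)).trans_lt (mem_ball_iff_norm.1 hw')
      simpa using this
    obtain ⟨h1, h2⟩ := abs_lt.1 hre
    rcases le_total 0 (X x) with h0 | h0
    · have : Real.exp (w'.re * X x) ≤ Real.exp ((w.re + 1) * X x) := by
        gcongr; linarith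
      linarith [Real.exp_pos ((w.re - 1) * X x)]
    · have : Real.exp (w'.re * X x) ≤ Real.exp ((w.re - 1) * X x) :=
        Real.exp_le_exp.2 (mul_le_mul_of_nonpos_right (by linarith) h0)
      linarith [Real.exp_pos ((w.re + 1) * X x)]
  · refine Filter.Eventually.of_forall fun x w' _ => ?_
    have h1 : HasDerivAt (fun w : ℂ => w * (X x : ℂ)) (X x : ℂ) w' := by
      simpa using (hasDerivAt_id w').mul_const (X x : ℂ)
    have h2 := (h1.cexp).mul_const (g x)
    rwa [mul_assoc] at h2

/-- One-variable Miyachi principle for the Fourier transform of a function `k` along `X`. -/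
theorem exp_mul_integral_cexp_const {Ω : Type*} [MeasurableSpace Ω] {μ : Measure Ω} {X : Ω → ℝ}
    (hX : Measurable X) {k : Ω → ℂ} (hk : AEStronglyMeasurable k μ)
    (hint : ∀ t : ℝ, Integrable (fun x => Real.exp (t * X x) * ‖k x‖) μ) {C α : ℝ} (hα : 0 < α)
    (hbound : ∀ t : ℝ, ∫ x, Real.exp (t * X x) * ‖k x‖ ∂μ ≤ C * Real.exp (t ^ 2 / (4 * α)))
    {c : ℂ} (hc : c ≠ 0)
    (hlog : Integrable fun r : ℝ => Real.posLog ‖c * (Complex.exp (r ^ 2 / (4 * α)) *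
      ∫ x, Complex.exp (-(Complex.I * r) * X x) * k x ∂μ)‖) (r r' : ℝ) :
    Complex.exp (r ^ 2 / (4 * α)) * ∫ x, Complex.exp (-(Complex.I * r) * X x) * k x ∂μ =
      Complex.exp (r' ^ 2 / (4 * α)) * ∫ x, Complex.exp (-(Complex.I * r') * X x) * k x ∂μ := by
  set h : ℂ → ℂ := fun z => c * (Complex.exp (z ^ 2 / (4 * α)) *
    ∫ x, Complex.exp (-(Complex.I * z) * X x) * k x ∂μ) with hh
  have hd : Differentiable ℂ h := by
    have h1 : Differentiable ℂ fun w : ℂ => ∫ x, Complex.exp (w * X x) * k x ∂μ :=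
      fun w => (hasDerivAt_integral_cexp_mul hX hk hint w).differentiableAt
    have h2 : Differentiable ℂ fun z : ℂ => ∫ x, Complex.exp (-(Complex.I * z) * X x) * k x ∂μ :=
      h1.comp (by fun_prop : Differentiable ℂ fun z : ℂ => -(Complex.I * z))
    exact (((by fun_prop : Differentiable ℂ fun z : ℂ => Complex.exp (z ^ 2 / (4 * α))).mul h2)).const_mul c
  -- The Gaussian factor has modulus e^{((Re z)² - (Im z)²)/(4α)} and the integral is at most C
  -- e^{(Im z)²/(4α)}: the dependence on Im z cancels.
  have hgrow : ∀ z, ‖h z‖ ≤ ‖c‖ * C * Real.exp (1 / (4 * α) * z.re ^ 2) := by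
    intro z
    have h1 : ‖∫ x, Complex.exp (-(Complex.I * z) * X x) * k x ∂μ‖ ≤
        C * Real.exp (z.im ^ 2 / (4 * α)) := by
      refine (norm_integral_le_integral_norm _).trans (le_trans (le_of_eq ?_) (hbound z.im))
      refine integral_congr_ae (Filter.Eventually.of_forall fun x => ?_)
      simp only [norm_mul, Complex.norm_exp]
      simp
    have h2 : ‖Complex.exp (z ^ 2 / (4 * α))‖ = Real.exp ((z.re ^ 2 - z.im ^ 2) / (4 * α)) := by
      rw [Complex.norm_exp]
      congr 1
      rw [show (4 * α : ℂ) = ((4 * α : ℝ) : ℂ) by push_cast; rfl, Complex.div_ofReal_re]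
      simp [sq]
    rw [hh, norm_mul, norm_mul, h2, mul_assoc]
    refine mul_le_mul_of_nonneg_left ?_ (norm_nonneg c)
    refine (mul_le_mul_of_nonneg_left h1 (Real.exp_pos _).le).trans (le_of_eq ?_)
    rw [mul_left_comm, ← Real.exp_add]
    congr 2
    ring
  have := hd.apply_eq_apply_of_integrable_posLog (by positivity) hgrow hlog r r'
  exact mul_left_cancel₀ hc this

/-! ### Complex Fourier transforms on the plane -/

/-- The map `(y₀, y₁) ↦ (y₀, s y₁)`. -/
noncomputable def signFlip (s : ℝ) (y : QFT.Plane) : QFT.Plane := !₂[y 0, s * y 1]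

@[simp] theorem signFlip_zero_coord (s : ℝ) (y : QFT.Plane) : signFlip s y 0 = y 0 := rfl
@[simp] theorem signFlip_one_coord (s : ℝ) (y : QFT.Plane) : signFlip s y 1 = s * y 1 := rfl

theorem plane_inner (x y : QFT.Plane) : inner ℝ x y = x 0 * y 0 + x 1 * y 1 := by
  simp [PiLp.inner_apply, Fin.sum_univ_two, mul_comm]

theorem plane_norm_sq (x : QFT.Plane) : ‖x‖ ^ 2 = x 0 ^ 2 + x 1 ^ 2 := by
  simp [EuclideanSpace.norm_sq_eq, Fin.sum_univ_two]

theorem norm_signFlip {s : ℝ} (hs : s ^ 2 = 1) (y : QFT.Plane) : ‖signFlip s y‖ = ‖y‖ := by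
  rw [← sq_eq_sq₀ (norm_nonneg _) (norm_nonneg _), plane_norm_sq, plane_norm_sq]
  simp [mul_pow, hs]

theorem signFlip_signFlip {s : ℝ} (hs : s ^ 2 = 1) (y : QFT.Plane) :
    signFlip s (signFlip s y) = y := by
  ext i
  fin_cases i
  · rfl
  · change s * (s * y 1) = y 1
    rw [← mul_assoc, ← sq, hs, one_mul]

/-- The complex Fourier transform with phase `-(x₀ y₀ + s x₁ y₁)`. -/
noncomputable def signedFourier (s : ℝ) (g : QFT.Plane → ℂ) (y : QFT.Plane) : ℂ :=
  ∫ x : QFT.Plane, Complex.exp (-(Complex.I * (inner ℝ x (signFlip s y) : ℝ))) * g x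

theorem norm_cexp_neg_I_mul (t : ℝ) : ‖Complex.exp (-(Complex.I * t))‖ = 1 := by
  rw [Complex.norm_exp]; simp

theorem integrable_signed_phase_mul {g : QFT.Plane → ℂ} (hg : Integrable g) (s : ℝ)
    (y : QFT.Plane) :
    Integrable fun x => Complex.exp (-(Complex.I * (inner ℝ x (signFlip s y) : ℝ))) * g x := by
  refine hg.bdd_mul (c := 1) (by fun_prop : Continuous fun x : QFT.Plane =>
    Complex.exp (-(Complex.I * (inner ℝ x (signFlip s y) : ℝ)))).aestronglyMeasurable ?_
  exact Filter.Eventually.of_forall fun x => (norm_cexp_neg_I_mul _).le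

theorem continuous_signedFourier {g : QFT.Plane → ℂ} (hg : Integrable g) (s : ℝ) :
    Continuous (signedFourier s g) := by
  refine continuous_of_dominated (bound := fun x => ‖g x‖)
    (fun y => (integrable_signed_phase_mul hg s y).1) (fun y => ?_) hg.norm ?_
  · exact Filter.Eventually.of_forall fun x => by rw [norm_mul, norm_cexp_neg_I_mul, one_mul]
  · refine Filter.Eventually.of_forall fun x => ?_
    simp only [plane_inner, signFlip_zero_coord, signFlip_one_coord]
    fun_prop

theorem signedFourier_sub {g k : QFT.Plane → ℂ} (hg : Integrable g) (hk : Integrable k) (s : ℝ)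
    (y : QFT.Plane) :
    signedFourier s (fun x => g x - k x) y = signedFourier s g y - signedFourier s k y := by
  unfold signedFourier
  rw [← integral_sub (integrable_signed_phase_mul hg s y) (integrable_signed_phase_mul hk s y)]
  simp only [mul_sub]

theorem integrable_cexp_gaussian {κ : ℝ} (hκ : 0 < κ) :
    Integrable fun x : QFT.Plane => Complex.exp (-κ * ‖x‖ ^ 2) := by
  simpa using GaussianFourier.integrable_cexp_neg_mul_sq_norm_add (V := QFT.Plane) (b := (κ : ℂ))
    (by simpa using hκ) 0 0

theorem signedFourier_gaussian {κ : ℝ} (hκ : 0 < κ) {s : ℝ} (hs : s ^ 2 = 1) (c : ℂ)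
    (y : QFT.Plane) :
    signedFourier s (fun x => c * Complex.exp (-κ * ‖x‖ ^ 2)) y =
      c * (Real.pi / κ * Complex.exp (-‖y‖ ^ 2 / (4 * κ))) := by
  have h := GaussianFourier.integral_cexp_neg_mul_sq_norm_add (V := QFT.Plane) (b := (κ : ℂ))
    (by simpa using hκ) (-Complex.I) (signFlip s y)
  rw [norm_signFlip hs] at h
  have h2 : (Module.finrank ℝ QFT.Plane / 2 : ℂ) = 1 := by simp
  rw [h2, Complex.cpow_one, neg_sq, Complex.I_sq, neg_one_mul] at h
  rw [← h, ← integral_const_mul]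
  unfold signedFourier
  refine integral_congr_ae (Filter.Eventually.of_forall fun x => ?_)
  simp only
  rw [mul_left_comm, ← Complex.exp_add, real_inner_comm]
  congr 2; ring

/-- Uniqueness for the Fourier transform of integrable functions. -/
theorem ae_eq_zero_of_signedFourier_eq_zero {g : QFT.Plane → ℂ} (hg : Integrable g) {s : ℝ}
    (hs : s ^ 2 = 1) (h0 : ∀ y, signedFourier s g y = 0) : g =ᵐ[volume] 0 := by
  -- `FourierTransform.fourier` has phase -2π⟨x, y⟩, hence the evaluation at the flipped point 2πy.
  have h1 : ∀ y, FourierTransform.fourier g y = 0 := by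
    intro y
    rw [← h0 (signFlip s ((2 * Real.pi) • y)), Real.fourier_eq', signedFourier]
    refine integral_congr_ae (Filter.Eventually.of_forall fun x => ?_)
    simp only [smul_eq_mul, signFlip_signFlip hs, inner_smul_right]
    congr 2
    push_cast; ring
  -- Every test function is the transform of a Schwartz function ψ, and ∫ ψ̂ g = ∫ ψ ĝ = 0.
  refine ae_eq_zero_of_integral_contDiff_smul_eq_zero hg.locallyIntegrable
    fun φ hφ hsupp => ?_
  have hg₁ : HasCompactSupport (Complex.ofRealCLM ∘ φ) := hsupp.comp_left rfl
  have hg₂ : ContDiff ℝ (⊤ : ℕ∞) (Complex.ofRealCLM ∘ φ) := Complex.ofRealCLM.contDiff.comp hφ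
  set S := hg₁.toSchwartzMap hg₂ with hS
  set ψ := FourierTransformInv.fourierInv S with hψ
  have hψS : FourierTransform.fourier (ψ : QFT.Plane → ℂ) = (S : QFT.Plane → ℂ) := by
    rw [← SchwartzMap.fourier_coe, hψ, FourierTransform.fourier_fourierInv_eq]
  have key : ∫ x, FourierTransform.fourier (ψ : QFT.Plane → ℂ) x • g x =
      ∫ x, ψ x • FourierTransform.fourier g x := by
    simpa using! (VectorFourier.integral_fourierIntegral_smul_eq_flip (L := innerₗ QFT.Plane)
      Real.continuous_fourierChar continuous_inner ψ.integrable hg)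
  rw [hψS] at key
  simpa [h1, hS] using key

/-! ### Slicing, and Miyachi's theorem for the complex transform -/

/-- Fubini controls only almost every slice. Sets of full measure are dense, so continuity extends
constancy to all slices, and any two points are joined by two axis-parallel moves. -/
theorem apply_eq_apply_of_ae_slices {H : ℝ → ℝ → ℂ} (h₁ : ∀ u, Continuous fun v => H u v)
    (h₂ : ∀ v, Continuous fun u => H u v)
    (hs₁ : ∀ᵐ v : ℝ, ∀ u u', H u v = H u' v) (hs₂ : ∀ᵐ u : ℝ, ∀ v v', H u v = H u v')
    (u v u' v' : ℝ) : H u v = H u' v' := by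
  have k₁ : ∀ u u' v, H u v = H u' v := fun u u' v =>
    congrFun ((h₁ u).ext_on (Measure.dense_of_ae hs₁) (h₁ u') fun v hv => hv u u') v
  have k₂ : ∀ v v' u, H u v = H u v' := fun v v' u =>
    congrFun ((h₂ v).ext_on (Measure.dense_of_ae hs₂) (h₂ v') fun u hu => hu v v') u
  rw [k₁ u u' v, k₂ v v' u']

theorem measurePreserving_plane_coords :
    MeasurePreserving (fun y : QFT.Plane => (y 0, y 1)) volume volume :=
  (volume_preserving_finTwoArrow ℝ).comp (PiLp.volume_preserving_ofLp (Fin 2))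

theorem integrable_slices {Φ : ℝ → ℝ → ℝ} (hc : Continuous (Function.uncurry Φ))
    (h0 : ∀ u v, 0 ≤ Φ u v)
    (hfin : ∫⁻ y : QFT.Plane, ENNReal.ofReal (Φ (y 0) (y 1)) < ∞) :
    (∀ᵐ v : ℝ, Integrable fun u => Φ u v) ∧ ∀ᵐ u : ℝ, Integrable fun v => Φ u v := by
  have h1 : Integrable (Function.uncurry Φ) (volume.prod volume) := by
    refine ⟨hc.aestronglyMeasurable, ?_⟩
    rw [hasFiniteIntegral_iff_ofReal (f := Function.uncurry Φ)
      (Filter.Eventually.of_forall fun p => h0 p.1 p.2)]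
    have := measurePreserving_plane_coords.lintegral_comp
      (f := fun p : ℝ × ℝ => ENNReal.ofReal (Function.uncurry Φ p))
      (ENNReal.continuous_ofReal.comp hc).measurable
    rw [← Measure.volume_eq_prod, ← this]
    exact hfin
  exact ⟨h1.prod_left_ae, h1.prod_right_ae⟩

/-- The unimodular ρ carries the phase of the frozen variable. It leaves norms unchanged, so the
Laplace bound at t • e is the one-variable bound at t. -/
theorem exp_mul_integral_phase_const {g : QFT.Plane → ℂ} (hg : AEStronglyMeasurable g volume)
    {C α : ℝ} (hα : 0 < α)
    (hlap : ∀ η : QFT.Plane, Integrable (fun x => Real.exp (inner ℝ η x) * ‖g x‖) ∧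
      ∫ x, Real.exp (inner ℝ η x) * ‖g x‖ ≤ C * Real.exp (‖η‖ ^ 2 / (4 * α)))
    {e : QFT.Plane} (he : ‖e‖ = 1) {ρ : QFT.Plane → ℂ} (hρ : Continuous ρ) (hρ1 : ∀ x, ‖ρ x‖ = 1)
    {c : ℂ} (hc : c ≠ 0)
    (hlog : Integrable fun r : ℝ => Real.posLog ‖c * (Complex.exp (r ^ 2 / (4 * α)) *
      ∫ x, Complex.exp (-(Complex.I * r) * (inner ℝ e x : ℝ)) * (ρ x * g x))‖) (r r' : ℝ) :
    Complex.exp (r ^ 2 / (4 * α)) *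
        ∫ x, Complex.exp (-(Complex.I * r) * (inner ℝ e x : ℝ)) * (ρ x * g x) =
      Complex.exp (r' ^ 2 / (4 * α)) *
        ∫ x, Complex.exp (-(Complex.I * r') * (inner ℝ e x : ℝ)) * (ρ x * g x) := by
  have hn : ∀ t : ℝ, ∀ x, Real.exp (t * inner ℝ e x) * ‖ρ x * g x‖ =
      Real.exp (inner ℝ (t • e) x) * ‖g x‖ := by
    intro t x
    rw [norm_mul, hρ1, one_mul, real_inner_smul_left]
  refine exp_mul_integral_cexp_const (X := fun x => inner ℝ e x) (k := fun x => ρ x * g x)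
    (by fun_prop : Continuous fun x : QFT.Plane => (inner ℝ e x : ℝ)).measurable
    (hρ.aestronglyMeasurable.mul hg) (fun t => ?_) hα (C := C) (fun t => ?_) hc hlog r r'
  · simp only [hn]; exact (hlap _).1
  · simp only [hn]
    refine (hlap _).2.trans (le_of_eq ?_)
    rw [norm_smul, he, mul_one, Real.norm_eq_abs, sq_abs]

/-- The function `e^{‖y‖²/(4α)}` times the Fourier transform of `g`, in coordinates. -/
noncomputable def weightedFourier (s α : ℝ) (g : QFT.Plane → ℂ) (u v : ℝ) : ℂ :=
  Complex.exp (‖(!₂[u, v] : QFT.Plane)‖ ^ 2 / (4 * α)) * signedFourier s g !₂[u, v]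

theorem weightedFourier_coords (s α : ℝ) (g : QFT.Plane → ℂ) (y : QFT.Plane) :
    weightedFourier s α g (y 0) (y 1) =
      Complex.exp (‖y‖ ^ 2 / (4 * α)) * signedFourier s g y := by
  have : (!₂[y 0, y 1] : QFT.Plane) = y := by
    ext i; fin_cases i <;> rfl
  rw [weightedFourier, this]

theorem continuous_weightedFourier {g : QFT.Plane → ℂ} (hg : Integrable g) (s α : ℝ) :
    Continuous (Function.uncurry (weightedFourier s α g)) := by
  have h1 : Continuous fun p : ℝ × ℝ => (!₂[p.1, p.2] : QFT.Plane) := by fun_prop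
  have h2 := (continuous_signedFourier hg s).comp h1
  have h3 : Continuous fun p : ℝ × ℝ =>
      Complex.exp (‖(!₂[p.1, p.2] : QFT.Plane)‖ ^ 2 / (4 * α)) := by fun_prop
  exact h3.mul h2

theorem cexp_norm_sq_div (α u v : ℝ) :
    Complex.exp ((‖(!₂[u, v] : QFT.Plane)‖ : ℂ) ^ 2 / (4 * α)) =
      Complex.exp (u ^ 2 / (4 * α)) * Complex.exp (v ^ 2 / (4 * α)) := by
  rw [← Complex.exp_add, ← Complex.ofReal_pow, plane_norm_sq, ← add_div]
  simp

/-- With v frozen, its Gaussian factor is absorbed in the constant c of the one-variable principle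
and its phase in ρ. -/
theorem weightedFourier_eq_slice_fst (s α : ℝ) (g : QFT.Plane → ℂ) (u v : ℝ) :
    weightedFourier s α g u v = Complex.exp (v ^ 2 / (4 * α)) * (Complex.exp (u ^ 2 / (4 * α)) *
      ∫ x : QFT.Plane, Complex.exp (-(Complex.I * u) * (inner ℝ (!₂[1, 0] : QFT.Plane) x : ℝ)) *
        (Complex.exp (-(Complex.I * ((s * v * x 1 : ℝ) : ℂ))) * g x)) := by
  rw [weightedFourier, cexp_norm_sq_div, signedFourier, mul_assoc, mul_left_comm]
  congr 3
  ext x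
  rw [← mul_assoc, ← Complex.exp_add, plane_inner, plane_inner]
  congr 2
  simp; ring

theorem weightedFourier_eq_slice_snd (s α : ℝ) (g : QFT.Plane → ℂ) (u v : ℝ) :
    weightedFourier s α g u v = Complex.exp (u ^ 2 / (4 * α)) * (Complex.exp (v ^ 2 / (4 * α)) *
      ∫ x : QFT.Plane, Complex.exp (-(Complex.I * v) * (inner ℝ (!₂[0, s] : QFT.Plane) x : ℝ)) *
        (Complex.exp (-(Complex.I * ((u * x 0 : ℝ) : ℂ))) * g x)) := by
  rw [weightedFourier, cexp_norm_sq_div, signedFourier, mul_assoc]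
  congr 3
  ext x
  rw [← mul_assoc, ← Complex.exp_add, plane_inner, plane_inner]
  congr 2
  simp; ring

/-- Miyachi's theorem in the critical case for the complex Fourier transform on the plane. -/
theorem ae_eq_gaussian_of_posLog {g : QFT.Plane → ℂ} (hg : AEStronglyMeasurable g volume)
    {C α : ℝ} (hα : 0 < α)
    (hlap : ∀ η : QFT.Plane, Integrable (fun x => Real.exp (inner ℝ η x) * ‖g x‖) ∧
      ∫ x, Real.exp (inner ℝ η x) * ‖g x‖ ≤ C * Real.exp (‖η‖ ^ 2 / (4 * α)))
    {s : ℝ} (hs : s ^ 2 = 1) {c : ℂ} (hc : c ≠ 0)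
    (hlog : ∫⁻ y : QFT.Plane, ENNReal.ofReal (Real.posLog
      ‖c * (Complex.exp (‖y‖ ^ 2 / (4 * α)) * signedFourier s g y)‖) < ∞) :
    ∃ d : ℂ, g =ᵐ[volume] fun x => d * Complex.exp (-α * ‖x‖ ^ 2) := by
  have hgi : Integrable g := by
    have := (hlap 0).1
    simp only [inner_zero_left, Real.exp_zero, one_mul] at this
    exact (integrable_norm_iff hg).1 this
  have hHc := continuous_weightedFourier hgi s α
  obtain ⟨hsl₁, hsl₂⟩ := integrable_slices
    (Φ := fun u v => Real.posLog ‖c * weightedFourier s α g u v‖)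
    (Real.continuous_posLog.comp (continuous_const.mul hHc).norm) (fun _ _ => Real.posLog_nonneg)
    (by simpa only [weightedFourier_coords] using hlog)
  have hn₁ : ‖(!₂[1, 0] : QFT.Plane)‖ = 1 := by
    rw [← sq_eq_sq₀ (norm_nonneg _) zero_le_one, plane_norm_sq]; simp
  have hn₂ : ‖(!₂[0, s] : QFT.Plane)‖ = 1 := by
    rw [← sq_eq_sq₀ (norm_nonneg _) zero_le_one, plane_norm_sq]; simp [hs]
  have hs₁ : ∀ᵐ v : ℝ, ∀ u u', weightedFourier s α g u v = weightedFourier s α g u' v := by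
    filter_upwards [hsl₁] with v hv u u'
    rw [weightedFourier_eq_slice_fst, weightedFourier_eq_slice_fst]
    congr 1
    simp only [weightedFourier_eq_slice_fst, ← mul_assoc c] at hv
    exact exp_mul_integral_phase_const hg hα hlap hn₁
      (ρ := fun x => Complex.exp (-(Complex.I * ((s * v * x 1 : ℝ) : ℂ)))) (by fun_prop)
      (fun x => norm_cexp_neg_I_mul _) (mul_ne_zero hc (Complex.exp_ne_zero _)) hv u u'
  have hs₂ : ∀ᵐ u : ℝ, ∀ v v', weightedFourier s α g u v = weightedFourier s α g u v' := by
    filter_upwards [hsl₂] with u hu v v'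
    rw [weightedFourier_eq_slice_snd, weightedFourier_eq_slice_snd]
    congr 1
    simp only [weightedFourier_eq_slice_snd, ← mul_assoc c] at hu
    exact exp_mul_integral_phase_const hg hα hlap hn₂
      (ρ := fun x => Complex.exp (-(Complex.I * ((u * x 0 : ℝ) : ℂ)))) (by fun_prop)
      (fun x => norm_cexp_neg_I_mul _) (mul_ne_zero hc (Complex.exp_ne_zero _)) hu v v'
  have hconst := apply_eq_apply_of_ae_slices
    (fun u => hHc.comp (continuous_const.prodMk continuous_id))
    (fun v => hHc.comp (continuous_id.prodMk continuous_const)) hs₁ hs₂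
  set H₀ := weightedFourier s α g 0 0 with hH₀
  -- The transform of e^{-α‖x‖²} is (π/α) e^{-‖y‖²/(4α)}, so this coefficient produces H₀
  -- e^{-‖y‖²/(4α)}.
  refine ⟨H₀ * (α / Real.pi), ?_⟩
  have hgau : Integrable fun x : QFT.Plane => H₀ * (α / Real.pi) * Complex.exp (-α * ‖x‖ ^ 2) :=
    (integrable_cexp_gaussian hα).const_mul _
  have h0 := ae_eq_zero_of_signedFourier_eq_zero (hgi.sub hgau) hs fun y => ?_
  · filter_upwards [h0] with x hx
    exact sub_eq_zero.1 hx
  · have h1 : Complex.exp (‖y‖ ^ 2 / (4 * α)) * signedFourier s g y = H₀ := by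
      rw [← weightedFourier_coords]; exact hconst _ _ _ _
    refine (signedFourier_sub hgi hgau s y).trans ?_
    rw [signedFourier_gaussian hα hs, ← h1]
    have hα' : (α : ℂ) ≠ 0 := by exact_mod_cast hα.ne'
    have hpi : (Real.pi : ℂ) ≠ 0 := by exact_mod_cast Real.pi_ne_zero
    have h3 : Complex.exp (‖y‖ ^ 2 / (4 * α)) * Complex.exp (-‖y‖ ^ 2 / (4 * α)) = 1 := by
      rw [← Complex.exp_add, ← Complex.exp_zero]; congr 1; ring
    have h4 : Complex.exp (‖y‖ ^ 2 / (4 * α)) * signedFourier s g y * (α / Real.pi) *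
        (Real.pi / α * Complex.exp (-‖y‖ ^ 2 / (4 * α))) =
        (Complex.exp (‖y‖ ^ 2 / (4 * α)) * Complex.exp (-‖y‖ ^ 2 / (4 * α))) *
          signedFourier s g y := by field_simp
    rw [h4, h3, one_mul, sub_self]

/-! ### Quaternions: reduction to the complex case, and the critical and supercritical cases -/

namespace QFT

theorem re_eq_zero_of_sq_eq_neg_one {a : ℍ[ℝ]} (ha : a ^ 2 = -1) : a.re = 0 := by
  rw [sq] at ha
  have h0 := congrArg QuaternionAlgebra.re ha
  have h1 := congrArg QuaternionAlgebra.imI ha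
  have h2 := congrArg QuaternionAlgebra.imJ ha
  have h3 := congrArg QuaternionAlgebra.imK ha
  simp only [Quaternion.re_mul, Quaternion.imI_mul, Quaternion.imJ_mul, Quaternion.imK_mul,
    Quaternion.re_neg, Quaternion.imI_neg, Quaternion.imJ_neg, Quaternion.imK_neg,
    Quaternion.re_one, Quaternion.imI_one, Quaternion.imJ_one, Quaternion.imK_one] at h0 h1 h2 h3
  by_contra hre
  have e1 : a.imI = 0 := mul_left_cancel₀ hre (by linarith)
  have e2 : a.imJ = 0 := mul_left_cancel₀ hre (by linarith)
  have e3 : a.imK = 0 := mul_left_cancel₀ hre (by linarith)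
  rw [e1, e2, e3] at h0
  nlinarith [sq_nonneg a.re]

theorem norm_eq_one_of_sq_eq_neg_one {a : ℍ[ℝ]} (ha : a ^ 2 = -1) : ‖a‖ = 1 := by
  have h := congrArg norm ha
  rw [norm_pow, norm_neg, norm_one] at h
  exact (pow_eq_one_iff_of_nonneg (norm_nonneg a) two_ne_zero).1 h

theorem exp_smul_of_sq_eq_neg_one {a : ℍ[ℝ]} (ha : a ^ 2 = -1) (t : ℝ) :
    NormedSpace.exp (t • a) = Real.cos t • (1 : ℍ[ℝ]) + Real.sin t • a := by
  rw [Quaternion.exp_of_re_eq_zero _ (by simp [re_eq_zero_of_sq_eq_neg_one ha]), norm_smul,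
    norm_eq_one_of_sq_eq_neg_one ha, mul_one, Real.norm_eq_abs, Real.cos_abs, smul_smul,
    ← Algebra.algebraMap_eq_smul_one]
  congr 2
  rcases eq_or_ne t 0 with rfl | ht
  · simp
  rcases lt_or_gt_of_ne ht with h | h
  · rw [abs_of_neg h, Real.sin_neg]; field_simp
  · rw [abs_of_pos h]; field_simp

theorem norm_exp_smul_of_sq_eq_neg_one {a : ℍ[ℝ]} (ha : a ^ 2 = -1) (t : ℝ) :
    ‖NormedSpace.exp (t • a)‖ = 1 := by
  rw [Quaternion.norm_exp]
  simp [re_eq_zero_of_sq_eq_neg_one ha]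

theorem integrable_transform_integrand {a b : ℍ[ℝ]} (ha : a ^ 2 = -1) (hb : b ^ 2 = -1)
    {f : Plane → ℍ[ℝ]} (hf : Integrable f) (y : Plane) :
    Integrable fun x : Plane =>
      NormedSpace.exp ((-(x 0 * y 0)) • a) * f x * NormedSpace.exp ((-(x 1 * y 1)) • b) := by
  have hc : ∀ (i : Fin 2) {c : ℍ[ℝ]}, c ^ 2 = -1 →
      Continuous fun x : Plane => NormedSpace.exp ((-(x i * y i)) • c) := by
    intro i c hc
    simp only [exp_smul_of_sq_eq_neg_one hc]
    fun_prop
  refine hf.norm.mono' (((hc 0 ha).aestronglyMeasurable.mul hf.1).mul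
    (hc 1 hb).aestronglyMeasurable) (Filter.Eventually.of_forall fun x => ?_)
  rw [norm_mul, norm_mul, norm_exp_smul_of_sq_eq_neg_one ha, norm_exp_smul_of_sq_eq_neg_one hb]
  simp

/-- A real-linear functional on `ℍ` made complex-linear for left multiplication by `a`, with
right multiplication by `b` acting as `s i`. -/
noncomputable def complexify (a b : ℍ[ℝ]) (ℓ : ℍ[ℝ] →L[ℝ] ℝ) (s : ℝ) : ℍ[ℝ] →L[ℝ] ℂ :=
  LinearMap.toContinuousLinearMap
    { toFun := fun q => (1 / 2 : ℂ) * ((ℓ q : ℂ) - s * ℓ (a * q * b) -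
        Complex.I * (ℓ (a * q) + s * ℓ (q * b)))
      map_add' := fun p q => by
        simp only [mul_add, add_mul, map_add, Complex.ofReal_add]; ring
      map_smul' := fun r q => by
        simp only [mul_smul_comm, smul_mul_assoc, map_smul, smul_eq_mul, Complex.ofReal_mul,
          RingHom.id_apply, Complex.real_smul]
        ring }

theorem complexify_apply (a b : ℍ[ℝ]) (ℓ : ℍ[ℝ] →L[ℝ] ℝ) (s : ℝ) (q : ℍ[ℝ]) :
    complexify a b ℓ s q = (1 / 2 : ℂ) * ((ℓ q : ℂ) - s * ℓ (a * q * b) -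
        Complex.I * (ℓ (a * q) + s * ℓ (q * b))) := rfl

theorem complexify_mul_left {a : ℍ[ℝ]} (ha : a ^ 2 = -1) (b : ℍ[ℝ]) (ℓ : ℍ[ℝ] →L[ℝ] ℝ) (s : ℝ)
    (q : ℍ[ℝ]) : complexify a b ℓ s (a * q) = Complex.I * complexify a b ℓ s q := by
  have h : a * (a * q) = -q := by rw [← mul_assoc, ← sq, ha, neg_one_mul]
  rw [complexify_apply, complexify_apply, h]
  simp only [neg_mul, map_neg, Complex.ofReal_neg]
  linear_combination ((1 / 2 : ℂ) * (ℓ (a * q) + s * ℓ (q * b))) * Complex.I_sq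

theorem complexify_mul_right (a : ℍ[ℝ]) {b : ℍ[ℝ]} (hb : b ^ 2 = -1) (ℓ : ℍ[ℝ] →L[ℝ] ℝ) {s : ℝ}
    (hs : s ^ 2 = 1) (q : ℍ[ℝ]) :
    complexify a b ℓ s (q * b) = s * Complex.I * complexify a b ℓ s q := by
  have h : ∀ p : ℍ[ℝ], p * b * b = -p := fun p => by rw [mul_assoc, ← sq, hb, mul_neg_one]
  have hs' : (s : ℂ) ^ 2 = 1 := by exact_mod_cast hs
  rw [complexify_apply, complexify_apply, h, ← mul_assoc a, h]
  simp only [map_neg, Complex.ofReal_neg]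
  linear_combination (1 / 2 : ℂ) * (ℓ (q * b) * s ^ 2 + s * ℓ (a * q)) * Complex.I_sq +
    (1 / 2 : ℂ) * (Complex.I * ℓ (a * q * b) - ℓ (q * b)) * hs'

/-- In the sum of the two real parts the terms carrying s cancel. So the values for s = ±1 together
recover ℓ, and varying ℓ recovers the quaternion. -/
theorem complexify_re_add (a b : ℍ[ℝ]) (ℓ : ℍ[ℝ] →L[ℝ] ℝ) (q : ℍ[ℝ]) :
    (complexify a b ℓ 1 q).re + (complexify a b ℓ (-1) q).re = ℓ q := by
  rw [complexify_apply, complexify_apply, ← Complex.add_re, ← mul_add]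
  simp
  ring

theorem complexify_exp_mul_mul_exp {a b : ℍ[ℝ]} (ha : a ^ 2 = -1) (hb : b ^ 2 = -1)
    (ℓ : ℍ[ℝ] →L[ℝ] ℝ) {s : ℝ} (hs : s ^ 2 = 1) (q : ℍ[ℝ]) (p r : ℝ) :
    complexify a b ℓ s (NormedSpace.exp ((-p) • a) * q * NormedSpace.exp ((-r) • b)) =
      Complex.exp (-(Complex.I * ((p + s * r : ℝ) : ℂ))) * complexify a b ℓ s q := by
  have hl : ∀ q, complexify a b ℓ s (NormedSpace.exp ((-p) • a) * q) =
      Complex.exp (-(p : ℂ) * Complex.I) * complexify a b ℓ s q := by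
    intro q
    rw [exp_smul_of_sq_eq_neg_one ha, add_mul, smul_mul_assoc, smul_mul_assoc, one_mul, map_add,
      map_smul, map_smul, complexify_mul_left ha, Complex.exp_mul_I]
    simp only [Complex.real_smul]
    push_cast
    ring
  have hr : ∀ q, complexify a b ℓ s (q * NormedSpace.exp ((-r) • b)) =
      Complex.exp (-((s * r : ℝ) : ℂ) * Complex.I) * complexify a b ℓ s q := by
    intro q
    rw [exp_smul_of_sq_eq_neg_one hb, mul_add, mul_smul_comm, mul_smul_comm, mul_one, map_add,
      map_smul, map_smul, complexify_mul_right a hb ℓ hs, Complex.exp_mul_I]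
    simp only [Complex.real_smul]
    rw [← Complex.ofReal_neg, ← Complex.ofReal_cos, ← Complex.ofReal_sin]
    -- Only for these signs are cos (s r) = cos r and sin (s r) = s sin r available.
    have h1 : s = 1 ∨ s = -1 := by
      rcases mul_eq_zero.1 (show (s - 1) * (s + 1) = 0 by linear_combination hs) with h | h
      · exact Or.inl (by linarith)
      · exact Or.inr (by linarith)
    rcases h1 with rfl | rfl <;> simp <;> ring
  rw [hr, hl, ← mul_assoc, ← Complex.exp_add]
  congr 2
  push_cast; ring

theorem complexify_transform {a b : ℍ[ℝ]} (ha : a ^ 2 = -1) (hb : b ^ 2 = -1)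
    (ℓ : ℍ[ℝ] →L[ℝ] ℝ) {s : ℝ} (hs : s ^ 2 = 1) {f : Plane → ℍ[ℝ]} (hf : Integrable f)
    (y : Plane) :
    complexify a b ℓ s (transform a b f y) =
      signedFourier s (fun x => complexify a b ℓ s (f x)) y := by
  rw [transform, ← ContinuousLinearMap.integral_comp_comm _
    (integrable_transform_integrand ha hb hf y), signedFourier]
  refine integral_congr_ae (Filter.Eventually.of_forall fun x => ?_)
  simp only
  rw [complexify_exp_mul_mul_exp ha hb ℓ hs, plane_inner]
  congr 4
  simp; ring

theorem eq_of_forall_complexify_eq (a b : ℍ[ℝ]) {p q : ℍ[ℝ]}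
    (h : ∀ (ℓ : ℍ[ℝ] →L[ℝ] ℝ) (s : ℝ), s ^ 2 = 1 →
      complexify a b ℓ s p = complexify a b ℓ s q) : p = q := by
  have h1 : ∀ ℓ : ℍ[ℝ] →L[ℝ] ℝ, ℓ p = ℓ q := fun ℓ => by
    rw [← complexify_re_add a b, h ℓ 1 (by norm_num), h ℓ (-1) (by norm_num), complexify_re_add]
  have h2 := h1 (innerSL ℝ (p - q))
  rw [← sub_eq_zero, ← map_sub, innerSL_apply_apply, real_inner_self_eq_norm_sq] at h2
  exact sub_eq_zero.1 (norm_eq_zero.1 (pow_eq_zero_iff two_ne_zero |>.1 h2))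

theorem transform_gaussian {a b : ℍ[ℝ]} (ha : a ^ 2 = -1) (hb : b ^ 2 = -1) {α : ℝ} (hα : 0 < α)
    (C : ℍ[ℝ]) (y : Plane) :
    transform a b (fun x => Real.exp (-α * ‖x‖ ^ 2) • C) y =
      (Real.pi / α * Real.exp (-‖y‖ ^ 2 / (4 * α))) • C := by
  have hi : Integrable fun x : Plane => Real.exp (-α * ‖x‖ ^ 2) • C :=
    (integrable_exp_neg_mul_sq_norm hα).smul_const C
  refine eq_of_forall_complexify_eq a b fun ℓ s hs => ?_
  rw [complexify_transform ha hb ℓ hs hi, map_smul, Complex.real_smul]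
  have := signedFourier_gaussian hα hs (complexify a b ℓ s C) y
  refine Eq.trans ?_ (this.trans ?_)
  · congr 1
    ext x
    rw [map_smul, Complex.real_smul]
    push_cast; ring
  · push_cast; ring

theorem logPlusFinite_mono {a b : ℍ[ℝ]} {β β' lam : ℝ} (hlam : 0 < lam) (hβ : β' ≤ β)
    {f : Plane → ℍ[ℝ]} (h : LogPlusFinite a b β lam f) : LogPlusFinite a b β' lam f := by
  refine lt_of_le_of_lt (lintegral_mono fun y => ENNReal.ofReal_le_ofReal ?_) h
  refine Real.posLog_le_posLog (by positivity) ?_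
  rw [norm_smul, norm_smul, Real.norm_eq_abs, Real.norm_eq_abs, Real.abs_exp, Real.abs_exp]
  gcongr

/-- In the critical case the functional `complexify` reduces to the complex theorem. -/
theorem exists_complexify_eq_gaussian {a b : ℍ[ℝ]} (ha : a ^ 2 = -1) (hb : b ^ 2 = -1)
    {α lam : ℝ} (hα : 0 < α) (hlam : 0 < lam) {n m : ℝ≥0∞} (hn : 1 ≤ n) (hm : 1 ≤ m)
    {f : Plane → ℍ[ℝ]} (hf : AEStronglyMeasurable f volume) (hA : GaussianSumMemLp α n m f)
    (hB : LogPlusFinite a b (1 / (4 * α)) lam f) (ℓ : ℍ[ℝ] →L[ℝ] ℝ) {s : ℝ} (hs : s ^ 2 = 1) :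
    ∃ d : ℂ, (fun x => complexify a b ℓ s (f x)) =ᵐ[volume]
      fun x => d * Complex.exp (-α * ‖x‖ ^ 2) := by
  obtain ⟨u, v, hu, hv, huv⟩ := hA
  obtain ⟨C, hC⟩ := exists_laplace_bound hα hn hm hf hu hv huv
  set T := complexify a b ℓ s with hT
  have hfi : Integrable f := by
    have := (hC 0).1
    simp only [inner_zero_left, Real.exp_zero, one_mul] at this
    exact (integrable_norm_iff hf).1 this
  have hg : AEStronglyMeasurable (fun x => T (f x)) volume :=
    T.continuous.comp_aestronglyMeasurable hf
  have hT0 : 0 < ‖T‖ + 1 := by positivity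
  have hsl : 0 < Real.sqrt lam := Real.sqrt_pos.2 hlam
  have hle : ∀ η x, Real.exp (inner ℝ η x) * ‖T (f x)‖ ≤
      ‖T‖ * (Real.exp (inner ℝ η x) * ‖f x‖) := by
    intro η x
    rw [mul_left_comm]
    gcongr
    exact T.le_opNorm _
  have hint : ∀ η, Integrable fun x => Real.exp (inner ℝ η x) * ‖T (f x)‖ := by
    intro η
    refine ((hC η).1.const_mul ‖T‖).mono' ?_ (Filter.Eventually.of_forall fun x => ?_)
    · exact (by fun_prop : Continuous fun x : Plane =>
        Real.exp (inner ℝ η x)).aestronglyMeasurable.mul hg.norm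
    · rw [Real.norm_of_nonneg (by positivity)]
      exact hle η x
  -- The constant c offsets both √lam and the operator norm of T, so that the argument of log⁺ is at
  -- most t, where t² is the argument in (B); then log⁺ t ≤ 2 log⁺ t = log⁺ t². The summand 1 covers
  -- T = 0.
  refine ae_eq_gaussian_of_posLog hg hα (C := ‖T‖ * C) (fun η => ⟨hint η, ?_⟩) hs
    (c := ((1 / (Real.sqrt lam * (‖T‖ + 1)) : ℝ) : ℂ)) (by
      rw [Ne, Complex.ofReal_eq_zero]; positivity) ?_
  · refine (integral_mono (hint η) ((hC η).1.const_mul _) (hle η)).trans ?_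
    rw [integral_const_mul, mul_assoc]
    gcongr
    exact (hC η).2
  · refine lt_of_le_of_lt (lintegral_mono fun y => ENNReal.ofReal_le_ofReal ?_) hB
    set t := ‖Real.exp (1 / (4 * α) * ‖y‖ ^ 2) • transform a b f y‖ / Real.sqrt lam with ht
    have ht2 : ‖Real.exp (1 / (4 * α) * ‖y‖ ^ 2) • transform a b f y‖ ^ 2 / lam = t ^ 2 := by
      rw [ht, div_pow, Real.sq_sqrt hlam.le]
    rw [ht2]
    have h1 : Real.posLog t ≤ Real.posLog (t ^ 2) := by
      rw [Real.posLog_pow]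
      have := Real.posLog_nonneg (x := t)
      push_cast; linarith
    refine le_trans (Real.posLog_le_posLog (norm_nonneg _) ?_) h1
    rw [← complexify_transform ha hb ℓ hs hfi, norm_mul, norm_mul, Complex.norm_real,
      Real.norm_of_nonneg (by positivity)]
    have h2 : ‖Complex.exp (‖y‖ ^ 2 / (4 * α))‖ = Real.exp (1 / (4 * α) * ‖y‖ ^ 2) := by
      rw [Complex.norm_exp]
      congr 1
      rw [show (‖y‖ ^ 2 / (4 * α) : ℂ) = ((‖y‖ ^ 2 / (4 * α) : ℝ) : ℂ) by push_cast; rfl,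
        Complex.ofReal_re]
      ring
    rw [h2, ht, norm_smul, Real.norm_eq_abs, Real.abs_exp]
    have h3 : ‖T (transform a b f y)‖ ≤ (‖T‖ + 1) * ‖transform a b f y‖ :=
      (T.le_opNorm _).trans (by gcongr; linarith)
    calc _ ≤ 1 / (Real.sqrt lam * (‖T‖ + 1)) * (Real.exp (1 / (4 * α) * ‖y‖ ^ 2) *
          ((‖T‖ + 1) * ‖transform a b f y‖)) := by gcongr
      _ = _ := by field_simp

theorem exists_ae_eq_gaussian {a b : ℍ[ℝ]} (ha : a ^ 2 = -1) (hb : b ^ 2 = -1)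
    {α lam : ℝ} (hα : 0 < α) (hlam : 0 < lam) {n m : ℝ≥0∞} (hn : 1 ≤ n) (hm : 1 ≤ m)
    {f : Plane → ℍ[ℝ]} (hf : AEStronglyMeasurable f volume) (hA : GaussianSumMemLp α n m f)
    (hB : LogPlusFinite a b (1 / (4 * α)) lam f) :
    ∃ C : ℍ[ℝ], f =ᵐ[volume] fun x => Real.exp (-α * ‖x‖ ^ 2) • C := by
  have key : ∀ ℓ : ℍ[ℝ] →L[ℝ] ℝ, ∃ d : ℝ, ∀ᵐ x, ℓ (f x) = d * Real.exp (-α * ‖x‖ ^ 2) := by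
    intro ℓ
    obtain ⟨d₁, h₁⟩ := exists_complexify_eq_gaussian ha hb hα hlam hn hm hf hA hB ℓ
      (s := 1) (by norm_num)
    obtain ⟨d₂, h₂⟩ := exists_complexify_eq_gaussian ha hb hα hlam hn hm hf hA hB ℓ
      (s := -1) (by norm_num)
    refine ⟨d₁.re + d₂.re, ?_⟩
    filter_upwards [h₁, h₂] with x hx₁ hx₂
    have he : Complex.exp (-α * ‖x‖ ^ 2) = ((Real.exp (-α * ‖x‖ ^ 2) : ℝ) : ℂ) := by push_cast; rfl
    rw [← complexify_re_add a b, hx₁, hx₂, he, Complex.re_mul_ofReal, Complex.re_mul_ofReal]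
    ring
  let B := stdOrthonormalBasis ℝ ℍ[ℝ]
  choose d hd using fun i => key (innerSL ℝ (B i))
  refine ⟨∑ i, d i • B i, ?_⟩
  filter_upwards [ae_all_iff.2 hd] with x hx
  rw [← B.sum_repr' (f x), Finset.smul_sum]
  refine Finset.sum_congr rfl fun i _ => ?_
  have := hx i
  rw [innerSL_apply_apply] at this
  rw [this, smul_smul, mul_comm]

/-- For a Gaussian the integrand of (B) is explicit: the decay e^{-‖y‖²/(4α)} of the transform
leaves the exponent β - 1/(4α). -/
theorem lintegral_posLog_gaussian_lt_top {a b : ℍ[ℝ]} (ha : a ^ 2 = -1) (hb : b ^ 2 = -1)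
    {α β lam : ℝ} (hα : 0 < α) {C : ℍ[ℝ]}
    {f : Plane → ℍ[ℝ]} (hf : f =ᵐ[volume] fun x => Real.exp (-α * ‖x‖ ^ 2) • C)
    (hB : LogPlusFinite a b β lam f) :
    ∫⁻ y : Plane, ENNReal.ofReal (Real.posLog
      ((Real.pi / α * ‖C‖ * Real.exp ((β - 1 / (4 * α)) * ‖y‖ ^ 2)) ^ 2 / lam)) < ∞ := by
  refine lt_of_eq_of_lt (lintegral_congr fun y => ?_) hB
  have h1 : transform a b f y = transform a b (fun x => Real.exp (-α * ‖x‖ ^ 2) • C) y := by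
    refine integral_congr_ae ?_
    filter_upwards [hf] with x hx
    rw [hx]
  rw [h1, transform_gaussian ha hb hα, smul_smul, norm_smul, Real.norm_of_nonneg (by positivity)]
  congr 4
  rw [mul_left_comm, ← Real.exp_add, mul_right_comm]
  congr 2
  ring_nf

/-- At the critical exponent the integrand is constant on a space of infinite measure, hence zero,
and log⁺ vanishes only on arguments at most 1. -/
theorem norm_le_of_logPlusFinite {a b : ℍ[ℝ]} (ha : a ^ 2 = -1) (hb : b ^ 2 = -1)
    {α lam : ℝ} (hα : 0 < α) (hlam : 0 < lam) {C : ℍ[ℝ]} {f : Plane → ℍ[ℝ]}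
    (hf : f =ᵐ[volume] fun x => Real.exp (-α * ‖x‖ ^ 2) • C)
    (hB : LogPlusFinite a b (1 / (4 * α)) lam f) : ‖C‖ ≤ α / Real.pi * Real.sqrt lam := by
  have h := lintegral_posLog_gaussian_lt_top ha hb hα hf hB
  simp only [sub_self, zero_mul, Real.exp_zero, mul_one, lintegral_const] at h
  have hvol : (volume : Measure Plane) Set.univ = ∞ := measure_univ_of_isAddLeftInvariant _
  rw [hvol] at h
  have h0 : Real.posLog ((Real.pi / α * ‖C‖) ^ 2 / lam) = 0 := by
    by_contra hne
    refine h.ne (ENNReal.mul_top ?_)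
    rw [Ne, ENNReal.ofReal_eq_zero, not_le]
    exact lt_of_le_of_ne Real.posLog_nonneg (Ne.symm hne)
  rw [Real.posLog_eq_zero_iff, abs_of_nonneg (by positivity), div_le_one hlam] at h0
  have h1 := Real.le_sqrt_of_sq_le h0
  have hpi := Real.pi_pos
  rw [div_mul_eq_mul_div, div_le_iff₀ hα] at h1
  rw [div_mul_eq_mul_div, le_div_iff₀ hpi]
  linarith

/-- If C ≠ 0, the integrand tends to infinity with ‖y‖. It is then at least 1 outside a ball, a set
of infinite measure. -/
theorem eq_zero_of_logPlusFinite {a b : ℍ[ℝ]} (ha : a ^ 2 = -1) (hb : b ^ 2 = -1)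
    {α β lam : ℝ} (hα : 0 < α) (hlam : 0 < lam) (hβ : 1 / (4 * α) < β) {C : ℍ[ℝ]}
    {f : Plane → ℍ[ℝ]} (hf : f =ᵐ[volume] fun x => Real.exp (-α * ‖x‖ ^ 2) • C)
    (hB : LogPlusFinite a b β lam f) : C = 0 := by
  by_contra hC
  have hC0 : 0 < ‖C‖ := norm_pos_iff.2 hC
  have h := lintegral_posLog_gaussian_lt_top ha hb hα hf hB
  have hε : 0 < β - 1 / (4 * α) := by linarith
  set ε := β - 1 / (4 * α)
  set k := Real.pi / α * ‖C‖ with hk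
  have hk0 : 0 < k := by have := Real.pi_pos; positivity
  have hlim : Filter.Tendsto (fun r : ℝ => Real.log (k ^ 2 / lam) + 2 * ε * r) Filter.atTop
      Filter.atTop :=
    Filter.tendsto_atTop_add_const_left _ _
      (Filter.Tendsto.const_mul_atTop (by positivity) Filter.tendsto_id)
  obtain ⟨R, hR⟩ := Filter.eventually_atTop.1 (hlim.eventually_ge_atTop 1)
  -- The bound R' ≥ 1 gives ‖y‖² ≥ ‖y‖ > R outside the ball.
  set R' := max R 1
  have hR1 : 1 ≤ R' := le_max_right _ _
  have hge : ∀ y ∈ (Metric.closedBall (0 : Plane) R')ᶜ, (1 : ℝ≥0∞) ≤ ENNReal.ofReal (Real.posLog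
      ((k * Real.exp (ε * ‖y‖ ^ 2)) ^ 2 / lam)) := by
    intro y hy
    rw [Set.mem_compl_iff, mem_closedBall_zero_iff, not_le] at hy
    rw [← ENNReal.ofReal_one]
    refine ENNReal.ofReal_le_ofReal ?_
    refine (hR (‖y‖ ^ 2) (by nlinarith [le_max_left R 1])).trans ?_
    rw [Real.posLog_apply]
    refine le_trans (le_of_eq ?_) (le_max_right _ _)
    have hsq : (k * Real.exp (ε * ‖y‖ ^ 2)) ^ 2 / lam =
        k ^ 2 / lam * Real.exp (2 * ε * ‖y‖ ^ 2) := by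
      rw [mul_pow k, ← Real.exp_nat_mul, mul_div_right_comm]
      congr 2; push_cast; ring
    rw [hsq, Real.log_mul (by positivity) (by positivity), Real.log_exp]
  have h1 : (volume : Measure Plane) (Metric.closedBall (0 : Plane) R')ᶜ < ∞ := by
    refine lt_of_le_of_lt ?_ h
    rw [← setLIntegral_one]
    exact (setLIntegral_mono' Metric.isClosed_closedBall.measurableSet.compl hge).trans
      (setLIntegral_le_lintegral _ _)
  have hvol : (volume : Measure Plane) Set.univ = ∞ := measure_univ_of_isAddLeftInvariant _
  have h2 := measure_union_lt_top (measure_closedBall_lt_top (x := (0 : Plane)) (r := R')) h1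
  rw [Set.union_compl_self, hvol] at h2
  exact lt_irrefl _ h2

end QFT

/-! ### Fourier decay of polynomials times Gaussians -/

theorem exists_norm_le_exp_sq {ε : ℝ} (hε : 0 < ε) :
    ∃ K : ℝ, 0 ≤ K ∧ ∀ t : ℝ, |t| ≤ K * Real.exp (ε * t ^ 2) := by
  refine ⟨1 + 1 / ε, by positivity, fun t => ?_⟩
  have h1 : |t| ≤ 1 + t ^ 2 := by
    rw [← sq_abs t]; nlinarith [sq_nonneg (|t| - 1), abs_nonneg t]
  have h2 := Real.add_one_le_exp (ε * t ^ 2)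
  have h3 : 1 ≤ Real.exp (ε * t ^ 2) := Real.one_le_exp (by positivity)
  have h4 : t ^ 2 ≤ 1 / ε * Real.exp (ε * t ^ 2) := by
    rw [div_mul_eq_mul_div, one_mul, le_div_iff₀ hε]; linarith
  linarith

theorem exists_pow_le_exp_sq (k : ℕ) : ∀ {ε : ℝ}, 0 < ε →
    ∃ K : ℝ, 0 ≤ K ∧ ∀ t : ℝ, |t| ^ k ≤ K * Real.exp (ε * t ^ 2) := by
  induction k with
  | zero =>
    intro ε hε
    exact ⟨1, zero_le_one, fun t => by simpa using Real.one_le_exp (by positivity : 0 ≤ ε * t ^ 2)⟩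
  | succ k ih =>
    intro ε hε
    obtain ⟨K₁, hK₁, h₁⟩ := ih (half_pos hε)
    obtain ⟨K₂, hK₂, h₂⟩ := exists_norm_le_exp_sq (half_pos hε)
    refine ⟨K₁ * K₂, by positivity, fun t => ?_⟩
    rw [pow_succ]
    refine (mul_le_mul (h₁ t) (h₂ t) (abs_nonneg _) (by positivity)).trans (le_of_eq ?_)
    rw [mul_mul_mul_comm, ← Real.exp_add]; congr 2; ring

theorem Polynomial.exists_norm_eval_le_exp_sq (p : Polynomial ℂ) {ε : ℝ} (hε : 0 < ε) :
    ∃ K : ℝ, 0 ≤ K ∧ ∀ w : ℂ, ‖p.eval w‖ ≤ K * Real.exp (ε * ‖w‖ ^ 2) := by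
  induction p using Polynomial.induction_on' with
  | add p q hp hq =>
    obtain ⟨K₁, hK₁, h₁⟩ := hp
    obtain ⟨K₂, hK₂, h₂⟩ := hq
    refine ⟨K₁ + K₂, by positivity, fun w => ?_⟩
    rw [Polynomial.eval_add, add_mul]
    exact (norm_add_le _ _).trans (add_le_add (h₁ w) (h₂ w))
  | monomial k c =>
    obtain ⟨K, hK, h⟩ := exists_pow_le_exp_sq k hε
    refine ⟨‖c‖ * K, by positivity, fun w => ?_⟩
    rw [Polynomial.eval_monomial, norm_mul, norm_pow, mul_assoc]
    have := h ‖w‖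
    rw [abs_norm] at this
    gcongr

theorem MvPolynomial.exists_abs_eval_le_exp_sq (p : MvPolynomial (Fin 2) ℝ) {ε : ℝ} (hε : 0 < ε) :
    ∃ K : ℝ, 0 ≤ K ∧ ∀ x : QFT.Plane, |MvPolynomial.eval (fun i => x i) p| ≤
      K * Real.exp (ε * ‖x‖ ^ 2) := by
  induction p using MvPolynomial.induction_on' generalizing ε with
  | add p q hp hq =>
    obtain ⟨K₁, hK₁, h₁⟩ := hp hε
    obtain ⟨K₂, hK₂, h₂⟩ := hq hε
    refine ⟨K₁ + K₂, by positivity, fun x => ?_⟩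
    rw [map_add, add_mul]
    exact (abs_add_le _ _).trans (add_le_add (h₁ x) (h₂ x))
  | monomial k c =>
    obtain ⟨K₀, hK₀, h₀⟩ := exists_pow_le_exp_sq (k 0) hε
    obtain ⟨K₁, hK₁, h₁⟩ := exists_pow_le_exp_sq (k 1) hε
    refine ⟨|c| * (K₀ * K₁), by positivity, fun x => ?_⟩
    rw [MvPolynomial.eval_monomial, Finsupp.prod_fintype _ _ (by simp), Fin.prod_univ_two, abs_mul,
      abs_mul, abs_pow, abs_pow, plane_norm_sq, mul_add, Real.exp_add, mul_assoc]
    gcongr |c| * ?_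
    refine (mul_le_mul (h₀ _) (h₁ _) (by positivity) (by positivity)).trans (le_of_eq ?_)
    ring

theorem integrable_exp_mul_norm_pow_mul_gaussian {κ : ℝ} (hκ : 0 < κ) (k : ℕ) (t : ℝ) :
    Integrable fun x : ℝ => Real.exp (t * x) * ‖(x : ℂ) ^ k * Complex.exp (-κ * x ^ 2)‖ := by
  induction k generalizing t with
  | zero =>
    have h := (integrable_cexp_quadratic (b := (κ : ℂ)) (by simpa using hκ) t 0).norm
    refine h.congr (Filter.Eventually.of_forall fun x => ?_)
    simp only [pow_zero, one_mul, add_zero]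
    rw [add_comm, Complex.exp_add, norm_mul, Complex.norm_exp (t * x)]
    simp
  | succ k ih =>
    have := integrable_exp_mul_norm_mul (X := fun x : ℝ => x) measurable_id
      (g := fun x : ℝ => (x : ℂ) ^ k * Complex.exp (-κ * x ^ 2))
      (by fun_prop : Continuous fun x : ℝ => (x : ℂ) ^ k *
        Complex.exp (-κ * x ^ 2)).aestronglyMeasurable ih t
    simpa only [pow_succ', mul_assoc] using this

/-- The Laplace transform of `x ^ k e^{-κ x²}` is a polynomial times a Gaussian. -/
theorem exists_polynomial_integral_pow_mul_gaussian {κ : ℝ} (hκ : 0 < κ) (k : ℕ) :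
    ∃ q : Polynomial ℂ, ∀ w : ℂ,
      ∫ x : ℝ, Complex.exp (w * x) * ((x : ℂ) ^ k * Complex.exp (-κ * x ^ 2)) =
        q.eval w * Complex.exp (w ^ 2 / (4 * κ)) := by
  induction k with
  | zero =>
    refine ⟨Polynomial.C ((Real.pi / κ) ^ (1 / 2 : ℂ)), fun w => ?_⟩
    have h := integral_cexp_quadratic (b := -(κ : ℂ)) (by simpa using hκ) w 0
    simp only [pow_zero, one_mul, Polynomial.eval_C]
    simp only [neg_neg, add_zero, zero_sub, mul_neg, div_neg] at h
    rw [← h]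
    refine integral_congr_ae (Filter.Eventually.of_forall fun x => ?_)
    simp only
    rw [← Complex.exp_add, add_comm]
  | succ k ih =>
    obtain ⟨q, hq⟩ := ih
    -- Differentiating in w brings down a factor x on the left, and on the right turns q into q' + q
    -- w/(2κ).
    refine ⟨q.derivative + q * (Polynomial.C (1 / (2 * κ : ℂ)) * Polynomial.X), fun w => ?_⟩
    have h1 := hasDerivAt_integral_cexp_mul (X := fun x : ℝ => x) measurable_id
      (g := fun x : ℝ => (x : ℂ) ^ k * Complex.exp (-κ * x ^ 2))
      (by fun_prop : Continuous fun x : ℝ => (x : ℂ) ^ k *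
        Complex.exp (-κ * x ^ 2)).aestronglyMeasurable
      (integrable_exp_mul_norm_pow_mul_gaussian hκ k) w
    have h2 : HasDerivAt (fun w : ℂ => q.eval w * Complex.exp (w ^ 2 / (4 * κ)))
        (q.derivative.eval w * Complex.exp (w ^ 2 / (4 * κ)) +
          q.eval w * (Complex.exp (w ^ 2 / (4 * κ)) * (2 * w / (4 * κ)))) w := by
      have h3 : HasDerivAt (fun w : ℂ => w ^ 2 / (4 * κ)) (2 * w / (4 * κ)) w := by
        simpa using (hasDerivAt_pow 2 w).div_const (4 * κ : ℂ)
      exact (q.hasDerivAt w).mul h3.cexp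
    have h4 := h1.unique (by simpa only [hq] using h2)
    simp only [pow_succ' _ k, mul_assoc]
    rw [h4]
    have hκ' : (κ : ℂ) ≠ 0 := by exact_mod_cast hκ.ne'
    simp only [Polynomial.eval_add, Polynomial.eval_mul, Polynomial.eval_C, Polynomial.eval_X]
    field_simp
    ring

/-- At w = -it the factor e^{w²/(4κ)} is e^{-t²/(4κ)}, and the gap 1/(4κ) - β absorbs the
polynomial. -/
theorem exists_norm_integral_pow_mul_gaussian_le {κ β : ℝ} (hκ : 0 < κ) (hβ : β < 1 / (4 * κ))
    (k : ℕ) : ∃ K : ℝ, 0 ≤ K ∧ ∀ t : ℝ,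
      ‖∫ x : ℝ, Complex.exp (-(Complex.I * t) * x) * ((x : ℂ) ^ k * Complex.exp (-κ * x ^ 2))‖ ≤
        K * Real.exp (-β * t ^ 2) := by
  obtain ⟨q, hq⟩ := exists_polynomial_integral_pow_mul_gaussian hκ k
  obtain ⟨K, hK, h⟩ := q.exists_norm_eval_le_exp_sq (sub_pos.2 hβ)
  refine ⟨K, hK, fun t => ?_⟩
  have h1 := h (-(Complex.I * t))
  have h2 : ‖Complex.exp ((-(Complex.I * t)) ^ 2 / (4 * κ))‖ = Real.exp (-(1 / (4 * κ)) * t ^ 2) := by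
    rw [neg_sq, mul_pow, Complex.I_sq,
      show (-1 * (t : ℂ) ^ 2 / (4 * κ)) = ((-(1 / (4 * κ)) * t ^ 2 : ℝ) : ℂ) by push_cast; ring,
      Complex.norm_exp, Complex.ofReal_re]
  rw [norm_neg, norm_mul, Complex.norm_I, one_mul, Complex.norm_real, Real.norm_eq_abs, sq_abs] at h1
  rw [hq, norm_mul, h2]
  refine (mul_le_mul_of_nonneg_right h1 (Real.exp_pos _).le).trans (le_of_eq ?_)
  rw [mul_assoc, ← Real.exp_add]
  congr 2; ring

theorem integral_plane_mul (f₀ f₁ : ℝ → ℂ) :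
    ∫ x : QFT.Plane, f₀ (x 0) * f₁ (x 1) = (∫ x, f₀ x) * ∫ x, f₁ x := by
  have h := integral_fintype_prod_volume_eq_prod (ι := Fin 2) (fun i => ![f₀, f₁] i)
  rw [Fin.prod_univ_two] at h
  simp only [Fin.prod_univ_two, Matrix.cons_val_zero, Matrix.cons_val_one] at h
  rw [← h]
  exact (PiLp.volume_preserving_ofLp (Fin 2)).integral_comp
    (MeasurableEquiv.toLp 2 (Fin 2 → ℝ)).symm.measurableEmbedding
    (fun x : Fin 2 → ℝ => f₀ (x 0) * f₁ (x 1))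

/-- Integrable functions whose Fourier transform is `O(e^{-β‖y‖²})`. -/
def HasGaussianDecay (s β : ℝ) (g : QFT.Plane → ℂ) : Prop :=
  Integrable g ∧ ∃ K : ℝ, ∀ y, ‖signedFourier s g y‖ ≤ K * Real.exp (-β * ‖y‖ ^ 2)

theorem HasGaussianDecay.add {s β : ℝ} {g k : QFT.Plane → ℂ} (hg : HasGaussianDecay s β g)
    (hk : HasGaussianDecay s β k) : HasGaussianDecay s β fun x => g x + k x := by
  obtain ⟨hgi, K₁, h₁⟩ := hg
  obtain ⟨hki, K₂, h₂⟩ := hk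
  refine ⟨hgi.add hki, K₁ + K₂, fun y => ?_⟩
  have : signedFourier s (fun x => g x + k x) y = signedFourier s g y + signedFourier s k y := by
    unfold signedFourier
    rw [← integral_add (integrable_signed_phase_mul hgi s y) (integrable_signed_phase_mul hki s y)]
    simp only [mul_add]
  rw [this, add_mul]
  exact (norm_add_le _ _).trans (add_le_add (h₁ y) (h₂ y))

theorem HasGaussianDecay.const_mul {s β : ℝ} {g : QFT.Plane → ℂ} (hg : HasGaussianDecay s β g)
    (c : ℂ) : HasGaussianDecay s β fun x => c * g x := by
  obtain ⟨hgi, K, h⟩ := hg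
  refine ⟨hgi.const_mul c, ‖c‖ * K, fun y => ?_⟩
  have : signedFourier s (fun x => c * g x) y = c * signedFourier s g y := by
    unfold signedFourier
    rw [← integral_const_mul]
    simp only [mul_left_comm]
  rw [this, norm_mul, mul_assoc]
  gcongr
  exact h y

theorem memLp_polynomial_mul_gaussian {κ : ℝ} (hκ : 0 < κ) (p : MvPolynomial (Fin 2) ℝ)
    (q : ℝ≥0∞) :
    MemLp (fun x : QFT.Plane => MvPolynomial.eval (fun i => x i) p * Real.exp (-κ * ‖x‖ ^ 2))
      q volume := by
  obtain ⟨K, hK, h⟩ := p.exists_abs_eval_le_exp_sq (half_pos hκ)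
  refine ((memLp_exp_neg_mul_sq_norm (V := QFT.Plane) (half_pos hκ) q).const_mul K).mono ?_
    (Filter.Eventually.of_forall fun x => ?_)
  · have : Continuous fun x : QFT.Plane => MvPolynomial.eval (fun i => x i) p :=
      (MvPolynomial.continuous_eval p).comp (by fun_prop)
    fun_prop
  · rw [Real.norm_eq_abs, Real.norm_eq_abs, abs_mul, Real.abs_exp, abs_mul, Real.abs_exp,
      abs_of_nonneg hK]
    refine (mul_le_mul_of_nonneg_right (h x) (Real.exp_pos _).le).trans (le_of_eq ?_)
    rw [mul_assoc, ← Real.exp_add]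
    congr 2; ring

/-- By additivity only monomials matter; for these the integrand splits and the transform is a
product of two one-variable integrals. -/
theorem hasGaussianDecay_polynomial_mul_gaussian {κ β : ℝ} (hκ : 0 < κ) (hβ : β < 1 / (4 * κ))
    {s : ℝ} (hs : s ^ 2 = 1) (p : MvPolynomial (Fin 2) ℝ) :
    HasGaussianDecay s β fun x : QFT.Plane =>
      ((MvPolynomial.eval (fun i => x i) p : ℝ) : ℂ) * Complex.exp (-κ * ‖x‖ ^ 2) := by
  induction p using MvPolynomial.induction_on' with
  | add p q hp hq =>
    simpa only [map_add, Complex.ofReal_add, add_mul] using hp.add hq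
  | monomial k c =>
    refine ⟨?_, ?_⟩
    · have := (memLp_one_iff_integrable.1
        (memLp_polynomial_mul_gaussian hκ (MvPolynomial.monomial k c) 1)).ofReal (𝕜 := ℂ)
      refine this.congr (Filter.Eventually.of_forall fun x => ?_)
      simp
    · obtain ⟨K₀, hK₀, h₀⟩ := exists_norm_integral_pow_mul_gaussian_le hκ hβ (k 0)
      obtain ⟨K₁, hK₁, h₁⟩ := exists_norm_integral_pow_mul_gaussian_le hκ hβ (k 1)
      refine ⟨|c| * (K₀ * K₁), fun y => ?_⟩
      have h2 : signedFourier s (fun x : QFT.Plane =>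
          ((MvPolynomial.eval (fun i => x i) (MvPolynomial.monomial k c) : ℝ) : ℂ) *
            Complex.exp (-κ * ‖x‖ ^ 2)) y =
          c * ((∫ x : ℝ, Complex.exp (-(Complex.I * (y 0 : ℝ)) * x) *
            ((x : ℂ) ^ k 0 * Complex.exp (-κ * x ^ 2))) *
          ∫ x : ℝ, Complex.exp (-(Complex.I * (s * y 1 : ℝ)) * x) *
            ((x : ℂ) ^ k 1 * Complex.exp (-κ * x ^ 2))) := by
        rw [← integral_plane_mul, signedFourier, ← integral_const_mul]
        refine integral_congr_ae (Filter.Eventually.of_forall fun x => ?_)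
        simp only
        rw [MvPolynomial.eval_monomial, Finsupp.prod_fintype _ _ (by simp), Fin.prod_univ_two,
          plane_inner, ← Complex.ofReal_pow, plane_norm_sq]
        have e1 : Complex.exp (-(Complex.I * ((x 0 * signFlip s y 0 + x 1 * signFlip s y 1 : ℝ) : ℂ))) =
            Complex.exp (-(Complex.I * (y 0 : ℝ)) * x 0) *
              Complex.exp (-(Complex.I * (s * y 1 : ℝ)) * x 1) := by
          rw [← Complex.exp_add]; congr 1; simp; ring
        have e2 : Complex.exp (-κ * ((x 0 ^ 2 + x 1 ^ 2 : ℝ) : ℂ)) =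
            Complex.exp (-κ * (x 0 : ℂ) ^ 2) * Complex.exp (-κ * (x 1 : ℂ) ^ 2) := by
          rw [← Complex.exp_add]; congr 1; push_cast; ring
        rw [e1, e2]
        push_cast
        ring
      have hy : ‖y‖ ^ 2 = y 0 ^ 2 + (s * y 1) ^ 2 := by rw [plane_norm_sq, mul_pow, hs, one_mul]
      rw [h2, norm_mul, norm_mul, Complex.norm_real, Real.norm_eq_abs, hy, mul_add, Real.exp_add,
        mul_assoc]
      gcongr |c| * ?_
      refine (mul_le_mul (h₀ _) (h₁ _) (norm_nonneg _) (by positivity)).trans (le_of_eq ?_)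
      ring

/-! ### The subcritical case -/

namespace QFT

/-- The gap β' - β sends the argument of log⁺ to 0, so the integrand vanishes outside a ball and is
bounded inside it. -/
theorem logPlusFinite_of_norm_transform_le {a b : ℍ[ℝ]} {β β' lam K : ℝ} (hβ : β < β')
    (hlam : 0 < lam) {f : Plane → ℍ[ℝ]}
    (h : ∀ y, ‖transform a b f y‖ ≤ K * Real.exp (-β' * ‖y‖ ^ 2)) : LogPlusFinite a b β lam f := by
  have hK : 0 ≤ K := by simpa using (norm_nonneg _).trans (h 0)
  set ε := β' - β with hε
  have hε0 : 0 < ε := sub_pos.2 hβ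
  have hle : ∀ y : Plane, ‖Real.exp (β * ‖y‖ ^ 2) • transform a b f y‖ ^ 2 / lam ≤
      K ^ 2 / lam * Real.exp (-(2 * ε) * ‖y‖ ^ 2) := by
    intro y
    have h1 : ‖Real.exp (β * ‖y‖ ^ 2) • transform a b f y‖ ≤ K * Real.exp (-ε * ‖y‖ ^ 2) := by
      rw [norm_smul, Real.norm_eq_abs, Real.abs_exp]
      refine (mul_le_mul_of_nonneg_left (h y) (Real.exp_pos _).le).trans (le_of_eq ?_)
      rw [mul_left_comm, ← Real.exp_add]; congr 2; rw [hε]; ring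
    have h2 : (K * Real.exp (-ε * ‖y‖ ^ 2)) ^ 2 = K ^ 2 * Real.exp (-(2 * ε) * ‖y‖ ^ 2) := by
      rw [mul_pow, ← Real.exp_nat_mul]; congr 2; push_cast; ring
    rw [div_mul_eq_mul_div, ← h2]
    gcongr
  have hlim : Filter.Tendsto (fun r : ℝ => K ^ 2 / lam * Real.exp (-(2 * ε * r))) Filter.atTop
      (nhds (K ^ 2 / lam * 0)) :=
    (Real.tendsto_exp_neg_atTop_nhds_zero.comp
      (Filter.Tendsto.const_mul_atTop (by positivity) Filter.tendsto_id)).const_mul _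
  rw [mul_zero] at hlim
  obtain ⟨R, hR⟩ := Filter.eventually_atTop.1 (hlim.eventually_le_const one_pos)
  set R' := max R 1
  have hR1 : 1 ≤ R' := le_max_right _ _
  refine lt_of_le_of_lt (lintegral_mono (g := (Metric.closedBall (0 : Plane) R').indicator
    fun _ => ENNReal.ofReal (Real.posLog (K ^ 2 / lam))) fun y => ?_) ?_
  · by_cases hy : y ∈ Metric.closedBall (0 : Plane) R'
    · rw [Set.indicator_of_mem hy]
      refine ENNReal.ofReal_le_ofReal (Real.posLog_le_posLog (by positivity) ((hle y).trans ?_))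
      refine mul_le_of_le_one_right (by positivity) (Real.exp_le_one_iff.2 ?_)
      nlinarith [sq_nonneg ‖y‖]
    · rw [Set.indicator_of_notMem hy]
      rw [mem_closedBall_zero_iff, not_le] at hy
      have h1 := hR (‖y‖ ^ 2) (by nlinarith [le_max_left R 1])
      rw [← neg_mul] at h1
      rw [nonpos_iff_eq_zero, ENNReal.ofReal_eq_zero, le_iff_lt_or_eq]
      right
      rw [Real.posLog_eq_zero_iff, abs_of_nonneg (by positivity)]
      exact (hle y).trans h1
  · rw [lintegral_indicator Metric.isClosed_closedBall.measurableSet, setLIntegral_const]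
    exact ENNReal.mul_lt_top ENNReal.ofReal_lt_top measure_closedBall_lt_top

theorem exists_norm_transform_le {a b : ℍ[ℝ]} (ha : a ^ 2 = -1) (hb : b ^ 2 = -1) {β : ℝ}
    {f : Plane → ℍ[ℝ]} (hf : Integrable f)
    (h : ∀ (ℓ : ℍ[ℝ] →L[ℝ] ℝ) (s : ℝ), s ^ 2 = 1 →
      HasGaussianDecay s β fun x => complexify a b ℓ s (f x)) :
    ∃ K : ℝ, ∀ y, ‖transform a b f y‖ ≤ K * Real.exp (-β * ‖y‖ ^ 2) := by
  have key : ∀ ℓ : ℍ[ℝ] →L[ℝ] ℝ, ∃ K : ℝ, ∀ y,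
      |ℓ (transform a b f y)| ≤ K * Real.exp (-β * ‖y‖ ^ 2) := by
    intro ℓ
    obtain ⟨-, K₁, h₁⟩ := h ℓ 1 (by norm_num)
    obtain ⟨-, K₂, h₂⟩ := h ℓ (-1) (by norm_num)
    refine ⟨K₁ + K₂, fun y => ?_⟩
    rw [← complexify_re_add a b, complexify_transform ha hb ℓ (by norm_num) hf,
      complexify_transform ha hb ℓ (by norm_num) hf, add_mul]
    exact (abs_add_le _ _).trans (add_le_add ((Complex.abs_re_le_norm _).trans (h₁ y))
      ((Complex.abs_re_le_norm _).trans (h₂ y)))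
  let B := stdOrthonormalBasis ℝ ℍ[ℝ]
  choose K hK using fun i => key (innerSL ℝ (B i))
  refine ⟨∑ i, K i, fun y => ?_⟩
  rw [← B.sum_repr' (transform a b f y), Finset.sum_mul]
  refine (norm_sum_le _ _).trans (Finset.sum_le_sum fun i _ => ?_)
  rw [norm_smul, B.orthonormal.1 i, mul_one, Real.norm_eq_abs]
  exact hK i y

theorem exists_quaternion_mk_eq : ∃ e₀ e₁ e₂ e₃ : ℍ[ℝ], ∀ r₀ r₁ r₂ r₃ : ℝ,
    (⟨r₀, r₁, r₂, r₃⟩ : ℍ[ℝ]) = r₀ • e₀ + r₁ • e₁ + r₂ • e₂ + r₃ • e₃ :=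
  ⟨⟨1, 0, 0, 0⟩, ⟨0, 1, 0, 0⟩, ⟨0, 0, 1, 0⟩, ⟨0, 0, 0, 1⟩, fun r₀ r₁ r₂ r₃ => by
    ext
    · change r₀ = r₀ * 1 + r₁ * 0 + r₂ * 0 + r₃ * 0; ring
    · change r₁ = r₀ * 0 + r₁ * 1 + r₂ * 0 + r₃ * 0; ring
    · change r₂ = r₀ * 0 + r₁ * 0 + r₂ * 1 + r₃ * 0; ring
    · change r₃ = r₀ * 0 + r₁ * 0 + r₂ * 0 + r₃ * 1; ring⟩

theorem polynomial_gaussian {a b : ℍ[ℝ]} (ha : a ^ 2 = -1) (hb : b ^ 2 = -1)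
    {α β lam δ : ℝ} (hβ : 0 < β) (hlam : 0 < lam) (n m : ℝ≥0∞) (hβδ : β < δ)
    (hδα : δ < 1 / (4 * α)) (hα : 0 < α) {P : Plane → ℍ[ℝ]} (hP : IsPolynomialFun P)
    {f : Plane → ℍ[ℝ]}
    (hf : ∀ x, f x = (1 / (2 * δ) ^ 2 * Real.exp (-‖x‖ ^ 2 / (4 * δ))) • P x) :
    GaussianSumMemLp α n m f ∧ LogPlusFinite a b β lam f := by
  have hδ : 0 < δ := hβ.trans hβδ
  obtain ⟨p₀, p₁, p₂, p₃, hp⟩ := hP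
  obtain ⟨e₀, e₁, e₂, e₃, he⟩ := exists_quaternion_mk_eq
  set c := 1 / (2 * δ) ^ 2 with hc
  set κ := 1 / (4 * δ) with hκ
  have hκ0 : 0 < κ := by positivity
  have hακ : α < κ := by
    rw [hκ, lt_div_iff₀ (by positivity)]
    rw [lt_div_iff₀ (by positivity)] at hδα
    linarith
  -- Used with r = α for condition (A) and with r = 0 for f itself.
  have hform : ∀ (r : ℝ) (x : Plane), Real.exp (r * ‖x‖ ^ 2) • f x =
      (MvPolynomial.eval (fun i => x i) p₀ * Real.exp (-(κ - r) * ‖x‖ ^ 2)) • (c • e₀) +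
      (MvPolynomial.eval (fun i => x i) p₁ * Real.exp (-(κ - r) * ‖x‖ ^ 2)) • (c • e₁) +
      (MvPolynomial.eval (fun i => x i) p₂ * Real.exp (-(κ - r) * ‖x‖ ^ 2)) • (c • e₂) +
      (MvPolynomial.eval (fun i => x i) p₃ * Real.exp (-(κ - r) * ‖x‖ ^ 2)) • (c • e₃) := by
    intro r x
    have hx : Real.exp (-(κ - r) * ‖x‖ ^ 2) =
        Real.exp (r * ‖x‖ ^ 2) * Real.exp (-‖x‖ ^ 2 / (4 * δ)) := by
      rw [← Real.exp_add]; congr 1; rw [hκ]; ring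
    rw [hf, hp, he, hx]
    module
  have hmem : ∀ (r : ℝ), r < κ → ∀ q : ℝ≥0∞,
      MemLp (fun x : Plane => Real.exp (r * ‖x‖ ^ 2) • f x) q volume := by
    intro r hr q
    simp only [hform]
    have hm : ∀ (p : MvPolynomial (Fin 2) ℝ) (e : ℍ[ℝ]), MemLp (fun x : Plane =>
        (MvPolynomial.eval (fun i => x i) p * Real.exp (-(κ - r) * ‖x‖ ^ 2)) • e) q volume := by
      intro p e
      exact (ContinuousLinearMap.toSpanSingleton ℝ e).comp_memLp'
        (memLp_polynomial_mul_gaussian (sub_pos.2 hr) p q)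
    exact (((hm p₀ _).add (hm p₁ _)).add (hm p₂ _)).add (hm p₃ _)
  refine ⟨⟨_, fun _ => 0, hmem α hακ n, MemLp.zero', by simp⟩, ?_⟩
  have hfi : Integrable f := by
    simpa using memLp_one_iff_integrable.1 (hmem 0 hκ0 1)
  -- Two gaps are needed: β' < δ = 1/(4κ) absorbs the polynomial in the transform, and β < β' makes
  -- the integral in (B) finite.
  obtain ⟨β', hβ', hβ'δ⟩ := exists_between hβδ
  have hβκ : β' < 1 / (4 * κ) := by
    rw [hκ]; field_simp; exact hβ'δ
  obtain ⟨K, hK⟩ := exists_norm_transform_le ha hb (β := β') hfi fun ℓ s hs => by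
    have hd : ∀ (p : MvPolynomial (Fin 2) ℝ) (e : ℍ[ℝ]), HasGaussianDecay s β' fun x : Plane =>
        complexify a b ℓ s
          ((MvPolynomial.eval (fun i => x i) p * Real.exp (-(κ - 0) * ‖x‖ ^ 2)) • e) := by
      intro p e
      have := (hasGaussianDecay_polynomial_mul_gaussian hκ0 hβκ hs p).const_mul
        (complexify a b ℓ s e)
      convert this using 2 with x
      rw [map_smul, Complex.real_smul, sub_zero]
      push_cast
      ring
    have h4 := (((hd p₀ (c • e₀)).add (hd p₁ (c • e₁))).add
      (hd p₂ (c • e₂))).add (hd p₃ (c • e₃))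
    simp only [← map_add, ← hform 0] at h4
    simpa only [zero_mul, Real.exp_zero, one_smul] using h4
  exact logPlusFinite_of_norm_transform_le hβ' hlam hK

end QFT

/-! ### The three cases together -/

theorem mainTheorem4 (a b : ℍ[ℝ]) (ha : a ^ 2 = -1) (hb : b ^ 2 = -1)
    (α β lam : ℝ) (hα : 0 < α) (hβ : 0 < β) (hlam : 0 < lam)
    (n m : ℝ≥0∞) (hn : 1 ≤ n) (hm : 1 ≤ m) :
    (1 / 4 < α * β →
      ∀ f : QFT.Plane → ℍ[ℝ], AEStronglyMeasurable f volume →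
        QFT.GaussianSumMemLp α n m f → QFT.LogPlusFinite a b β lam f →
        f =ᵐ[volume] fun _ => 0) ∧
    (α * β = 1 / 4 →
      ∀ f : QFT.Plane → ℍ[ℝ], AEStronglyMeasurable f volume →
        QFT.GaussianSumMemLp α n m f → QFT.LogPlusFinite a b β lam f →
        ∃ C : ℍ[ℝ], ‖C‖ ≤ α / Real.pi * Real.sqrt lam ∧
          f =ᵐ[volume] fun x => Real.exp (-α * ‖x‖ ^ 2) • C) ∧
    (α * β < 1 / 4 →
      ∀ δ : ℝ, β < δ → δ < 1 / (4 * α) →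
        ∀ P : QFT.Plane → ℍ[ℝ], QFT.IsPolynomialFun P →
          ∀ f : QFT.Plane → ℍ[ℝ],
            (∀ x, f x = (1 / (2 * δ) ^ 2 * Real.exp (-‖x‖ ^ 2 / (4 * δ))) • P x) →
            QFT.GaussianSumMemLp α n m f ∧ QFT.LogPlusFinite a b β lam f) := by
  refine ⟨fun h f hf hA hB => ?_, fun h f hf hA hB => ?_, fun _ δ hβδ hδα P hP f hf => ?_⟩
  · have hlt : 1 / (4 * α) < β := by
      rw [div_lt_iff₀ (by positivity)]; linarith
    -- (B) for β implies (B) for the smaller critical exponent, which determines the shape of f; (B)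
    -- for β itself then forces C = 0.
    obtain ⟨C, hC⟩ := QFT.exists_ae_eq_gaussian ha hb hα hlam hn hm hf hA
      (QFT.logPlusFinite_mono hlam hlt.le hB)
    rw [QFT.eq_zero_of_logPlusFinite ha hb hα hlam hlt hC hB] at hC
    simpa using hC
  · have heq : β = 1 / (4 * α) := by
      rw [eq_div_iff (by positivity)]; linarith
    rw [heq] at hB
    obtain ⟨C, hC⟩ := QFT.exists_ae_eq_gaussian ha hb hα hlam hn hm hf hA hB
    exact ⟨C, QFT.norm_le_of_logPlusFinite ha hb hα hlam hC hB, hC⟩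
  · exact QFT.polynomial_gaussian ha hb hβ hlam n m hβδ hδα hα hP hf
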